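/- **Setting.** Let $p,T_{\mathrm{ini}},T_{\mathrm{f}},T,N\ge 1$ and $m\geq 0$ be integers, $L=T_{\mathrm{ini}}+T_{\mathrm{f}}$, $K=\lfloor T/L\rfloor$, and let $d=pLK$; assume $d\ge 3$. Let $r,q\in[1,\infty]$ with $\frac1r+\frac1q=1$. The random output data is a random matrix $\xi=\begin{pmatrix}Y_{\mathrm p}\\ Y_{\mathrm f}\end{pmatrix}\in\mathbb R^{pL\times K}\cong\mathbb R^{d}$ with distribution $\mathbb P$, where $Y_{\mathrm p}$ consists of the first $pT_{\mathrm{ini}}$ rows and $Y_{\mathrm f}$ of the last $pT_{\mathrm f}$ rows, and $\|\xi\|_r$ is the $r$-norm of $\xi$ as a vector in $\mathbb R^d$. The data batches $\hat\xi^{(1)},\dots,\hat\xi^{(N)}$, with blocks $\widehat Y_{\mathrm p}^{(i)},\widehat Y_{\mathrm f}^{(i)}$, are i.i.d. with law $\mathbb P$, and $\widehat{\mathbb P}_N=\frac1N\sum_{i=1}^N\delta_{\hat\xi^{(i)}}$. Let $d_{\mathrm W}$ be the Wasserstein distance of order one, $d_{\mathrm W}(\mathbb Q_1,\mathbb Q_2)=\inf_{\Pi}\int\|\xi_1-\xi_2\|_r\,\Pi(\mathrm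 d\xi_1,\mathrm d\xi_2)$ over the couplings $\Pi$ of $\mathbb Q_1,\mathbb Q_2$. For an input sequence $\hat u_1,\dots,\hat u_T\in\mathbb R^m$ let $\widehat U_{\mathrm p}$, $\widehat U_{\mathrm f}$ be the first $T_{\mathrm{ini}}$ and the last $T_{\mathrm f}$ block rows of its Page matrix of depth $L$, whose block row $i$, column $j$ entry is $\hat u_{(j-1)L+i}$ ($1\le i\le L$, $1\le j\le K$). Let $\hat u_{\mathrm{ini}}\in\mathbb R^{mT_{\mathrm{ini}}}$, $\hat y_{\mathrm{ini}}\in\mathbb R^{pT_{\mathrm{ini}}}$, $\mathcal U\subseteq\mathbb R^{mT_{\mathrm f}}$, $\alpha\in(0,1)$; let $f_1:\mathbb R^{mT_{\mathrm f}}\to\mathbb R_{\ge0}$ be convex, let $f_2:\mathbb R^{pT_{\mathrm f}}\to\mathbb R_{\ge0}$, $f_3:\mathbb R^{pT_{\mathrm{ini}}}\to\mathbb R_{\ge0}$, $h:\mathbb R^{pT_{\mathrm f}}\to\mathbb R$ be convex and Lipschitz, and let $L_{\mathrm{obj}}>0$ and $L_{\mathrm{con}}>0$ be Lipschitz constants with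 respect to the $r$-norm of $(x,y)\mapsto f_2(x)+f_3(y)$ and of $h$. For a radius $\epsilon$, the tractable problem is to minimize over $g\in\mathbb R^{K},\tau\in\mathbb R,s\in\mathbb R^N$ $$\widehat J(g)=f_1(\widehat U_{\mathrm f}g)+\frac1N\sum_{i=1}^N\bigl(f_2(\widehat Y_{\mathrm f}^{(i)}g)+f_3(\widehat Y_{\mathrm p}^{(i)}g-\hat y_{\mathrm{ini}})\bigr)+L_{\mathrm{obj}}\,\epsilon\,\|g\|_q$$ subject to $\widehat U_{\mathrm p}g=\hat u_{\mathrm{ini}}$, $\widehat U_{\mathrm f}g\in\mathcal U$, $-\tau\alpha+L_{\mathrm{con}}\epsilon\|g\|_q+\frac1N\sum_{i}s_i\le0$, and $\tau+h(\widehat Y_{\mathrm f}^{(i)}g)\le s_i$, $s_i\ge0$ for all $i\le N$. Put $J(g)=\mathbb E_{\mathbb P}[f_1(\widehat U_{\mathrm f}g)+f_2(Y_{\mathrm f}g)+f_3(Y_{\mathrm p}g-\hat y_{\mathrm{ini}})]$ and $\mathrm{CVaR}^{\mathbb P}_{1-\alpha}(X)=\inf_{\tau\in\mathbb R}\{\tau+\frac1\alpha\mathbb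 E_{\mathbb P}[(X-\tau)_+]\}$. **Theorem (Robust Performance Guarantee).** Let $a>1$ and assume $\mathbb E_{\mathbb P}[\exp(\|\xi\|_r^a)]<\infty$. There are constants $c_1,c_2>0$, depending only on $a$, $d$ and (an upper bound for) $\mathbb E_{\mathbb P}[\exp(\|\xi\|_r^a)]$, such that for all $N\ge1$ the concentration bound $$\mathbb P^N\{d_{\mathrm W}(\mathbb P,\widehat{\mathbb P}_N)\ge\epsilon\}\le\begin{cases}c_1\exp(-c_2N\epsilon^{d}),&0<\epsilon\le1,\\ c_1\exp(-c_2N\epsilon^{a}),&\epsilon>1,\end{cases}$$ holds and such that, for every $\beta\in(0,1)$, if the radius is chosen by inverting this bound, $$\epsilon(\beta,N)=\begin{cases}\left(\dfrac{\log(c_1\beta^{-1})}{c_2N}\right)^{1/d},&N\ge\log(c_1\beta^{-1})/c_2,\\[2mm]\left(\dfrac{\log(c_1\beta^{-1})}{c_2N}\right)^{1/a},&N<\log(c_1\beta^{-1})/c_2,\end{cases}$$ then $f_1(\widehat U_{\mathrm f}g)+f_2(Y_{\mathrm f}g)+f_3(Y_{\mathrm p}g-\hat y_{\mathrm{ini}})$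 and $h(Y_{\mathrm f}g)$ are $\mathbb P$-integrable for every $g$ and, with $\mathbb P^N$-probability at least $1-\beta$ over the data batches, every optimizer $\hat g^\star$ of the tractable problem with radius $\epsilon(\beta,N)$ satisfies both $$J(\hat g^\star)\le\widehat J(\hat g^\star)\qquad\text{and}\qquad\mathrm{CVaR}^{\mathbb P}_{1-\alpha}(h(Y_{\mathrm f}\hat g^\star))\le0.$$ -/

import Mathlib

open MeasureTheory
open scoped ENNReal Matrix

noncomputable section

namespace DeePC

/-- The `r`-norm of a real vector with arbitrary finite index set, for `r ∈ [1, ∞]`. -/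
def rNorm {ι : Type*} [Fintype ι] (r : ℝ≥0∞) (x : ι → ℝ) : ℝ :=
  ‖(WithLp.toLp r x : PiLp r (fun _ : ι => ℝ))‖

/-- `L` is a positive Lipschitz constant of `f` with respect to the `r`-norm. -/
def HasLipschitzConst {ι : Type*} [Fintype ι] (r : ℝ≥0∞) (f : (ι → ℝ) → ℝ) (L : ℝ) : Prop :=
  0 < L ∧ ∀ x y : ι → ℝ, |f x - f y| ≤ L * rNorm r (x - y)

/-- Signals with `k` channels over a window of `L` time steps, stacked into one vector. -/
abbrev Window (L k : ℕ) : Type := Fin L × Fin k → ℝ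

/-- Index (counted from zero) of the sample in block row `i` and column `j`
of a Page matrix of depth `L`. -/
def pageIndex {L T : ℕ} (i : Fin L) (j : Fin (T / L)) : Fin T :=
  ⟨j * L + i, by
    have h1 : (j : ℕ) * L + L ≤ T / L * L := by
      have h := Nat.mul_le_mul_right L (Nat.succ_le_of_lt j.isLt)
      rwa [Nat.succ_mul] at h
    have h2 : T / L * L ≤ T := Nat.div_mul_le_self T L
    have h3 := i.isLt
    omega⟩

/-- The Page matrix of depth `L` of the sequence `u` of `T` vectors in `ℝᵏ`. -/
def pageMatrix {k T : ℕ} (L : ℕ) (u : Fin T → Fin k → ℝ) :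
    Matrix (Fin L × Fin k) (Fin (T / L)) ℝ :=
  fun i j => u (pageIndex i.1 j) i.2

/-- The first `Tini` block rows of a matrix with `Tini + Tf` block rows. -/
def pastRows {k Tini Tf K : ℕ} (Y : Fin (Tini + Tf) × Fin k → Fin K → ℝ) :
    Matrix (Fin Tini × Fin k) (Fin K) ℝ :=
  fun i j => Y (Fin.castAdd Tf i.1, i.2) j

/-- The last `Tf` block rows of a matrix with `Tini + Tf` block rows. -/
def futureRows {k Tini Tf K : ℕ} (Y : Fin (Tini + Tf) × Fin k → Fin K → ℝ) :
    Matrix (Fin Tf × Fin k) (Fin K) ℝ :=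
  fun i j => Y (Fin.natAdd Tini i.1, i.2) j

/-- The space in which the random output data matrix `ξ` (the rows of `Y_p` followed by those
of `Y_f`) takes its values, of dimension `p * (Tini + Tf) * ⌊T / (Tini + Tf)⌋`. -/
abbrev OutputData (p Tini Tf T : ℕ) : Type :=
  Fin (Tini + Tf) × Fin p → Fin (T / (Tini + Tf)) → ℝ

/-- The `r`-norm of an output data matrix, regarded as one long vector. -/
def dataNorm {p Tini Tf T : ℕ} (r : ℝ≥0∞) (ξ : OutputData p Tini Tf T) : ℝ :=
  rNorm r (fun ij : (Fin (Tini + Tf) × Fin p) × Fin (T / (Tini + Tf)) => ξ ij.1 ij.2)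

/-- The Wasserstein distance of order one with transport cost `‖ξ₁ - ξ₂‖_r`: the infimum of the
transport cost over all joint distributions with the two given marginals. -/
def wassersteinDist {p Tini Tf T : ℕ} (r : ℝ≥0∞) (Q₁ Q₂ : Measure (OutputData p Tini Tf T)) :
    ℝ≥0∞ :=
  ⨅ (γ : Measure (OutputData p Tini Tf T × OutputData p Tini Tf T))
    (_ : γ.map Prod.fst = Q₁ ∧ γ.map Prod.snd = Q₂),
    ∫⁻ z, ENNReal.ofReal (dataNorm r (z.1 - z.2)) ∂γ

/-- The empirical distribution of `N` samples. -/
def empirical {Ω : Type*} [MeasurableSpace Ω] {N : ℕ} (ξ : Fin N → Ω) : Measure Ω :=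
  (N : ℝ≥0∞)⁻¹ • ∑ i, Measure.dirac (ξ i)

/-- The conditional value at risk `CVaR_{1-α}` of `X` under `P`. -/
def cvar {Ω : Type*} [MeasurableSpace Ω] (α : ℝ) (P : Measure Ω) (X : Ω → ℝ) : ℝ :=
  ⨅ τ : ℝ, τ + 1 / α * ∫ ω, max (X ω - τ) 0 ∂P

/-- The concentration bound for samples of size `N` of a `d`-dimensional light-tailed
distribution with tail exponent `a`, as a function of the radius `ε`. -/
def concentrationBound (c₁ c₂ a : ℝ) (d N : ℕ) (ε : ℝ) : ℝ :=
  if ε ≤ 1 then c₁ * Real.exp (-c₂ * N * ε ^ d) else c₁ * Real.exp (-c₂ * N * ε ^ a)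

/-- The Wasserstein radius `ε(β, N)` obtained by inverting the concentration bound. -/
def wassersteinRadius (c₁ c₂ a : ℝ) (d : ℕ) (β : ℝ) (N : ℕ) : ℝ :=
  if Real.log (c₁ * β⁻¹) / c₂ ≤ N then
    (Real.log (c₁ * β⁻¹) / (c₂ * N)) ^ (1 / (d : ℝ))
  else
    (Real.log (c₁ * β⁻¹) / (c₂ * N)) ^ (1 / a)

/-- The deterministic data of a robust DeePC problem with `m` inputs and `p` outputs, initial
window `Tini`, prediction horizon `Tf` and experiments of length `T`, and the assumptions made on
them; norms in the space of trajectories are `r`-norms. -/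
structure Problem (m p Tini Tf T : ℕ) (r : ℝ≥0∞) where
  /-- the input sequence applied in every experiment -/
  uHat : Fin T → Fin m → ℝ
  /-- the most recent measured inputs -/
  uIni : Window Tini m
  /-- the most recent measured outputs -/
  yIni : Window Tini p
  /-- the input constraint set -/
  inputSet : Set (Window Tf m)
  /-- the cost of the future inputs -/
  f₁ : Window Tf m → ℝ
  /-- the cost of the future outputs -/
  f₂ : Window Tf p → ℝ
  /-- the estimation cost -/
  f₃ : Window Tini p → ℝ
  /-- the output constraint function: the desired outputs are those with `h y ≤ 0` -/
  h : Window Tf p → ℝ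
  /-- the risk level in the CVaR constraint -/
  α : ℝ
  /-- Lipschitz constant of `(x, y) ↦ f₂ x + f₃ y` -/
  Lobj : ℝ
  /-- Lipschitz constant of `h` -/
  Lcon : ℝ
  f₁_nonneg : ∀ x, 0 ≤ f₁ x
  f₂_nonneg : ∀ x, 0 ≤ f₂ x
  f₃_nonneg : ∀ x, 0 ≤ f₃ x
  f₁_convex : ConvexOn ℝ Set.univ f₁
  f₂_convex : ConvexOn ℝ Set.univ f₂
  f₃_convex : ConvexOn ℝ Set.univ f₃
  h_convex : ConvexOn ℝ Set.univ h
  objective_lipschitz : HasLipschitzConst r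
    (fun z : (Fin Tf × Fin p) ⊕ (Fin Tini × Fin p) → ℝ =>
      f₂ (fun i => z (Sum.inl i)) + f₃ (fun i => z (Sum.inr i))) Lobj
  h_lipschitz : HasLipschitzConst r h Lcon
  α_pos : 0 < α
  α_lt_one : α < 1

namespace Problem

variable {m p Tini Tf T N : ℕ} {r : ℝ≥0∞}

/-- The past input data matrix. -/
def Up (D : Problem m p Tini Tf T r) : Matrix (Fin Tini × Fin m) (Fin (T / (Tini + Tf))) ℝ :=
  pastRows (pageMatrix (Tini + Tf) D.uHat)

/-- The future input data matrix. -/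
def Uf (D : Problem m p Tini Tf T r) : Matrix (Fin Tf × Fin m) (Fin (T / (Tini + Tf))) ℝ :=
  futureRows (pageMatrix (Tini + Tf) D.uHat)

/-- The cost `f₁(U_f g) + f₂(Y_f g) + f₃(Y_p g - y_ini)` for the output data `ξ = (Y_p, Y_f)`. -/
def cost (D : Problem m p Tini Tf T r) (g : Fin (T / (Tini + Tf)) → ℝ)
    (ξ : OutputData p Tini Tf T) : ℝ :=
  D.f₁ (D.Uf *ᵥ g) + D.f₂ (futureRows ξ *ᵥ g) + D.f₃ (pastRows ξ *ᵥ g - D.yIni)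

/-- The constraint function `h(Y_f g)` for the output data `ξ = (Y_p, Y_f)`. -/
def constraint (D : Problem m p Tini Tf T r) (g : Fin (T / (Tini + Tf)) → ℝ)
    (ξ : OutputData p Tini Tf T) : ℝ :=
  D.h (futureRows ξ *ᵥ g)

/-- The expected cost `J(g)` under the distribution `P` of the output data. -/
def expectedCost (D : Problem m p Tini Tf T r) (P : Measure (OutputData p Tini Tf T))
    (g : Fin (T / (Tini + Tf)) → ℝ) : ℝ :=
  ∫ ξ, D.cost g ξ ∂P

/-- The objective `Ĵ(g)` of the tractable problem with radius `ε` and data batches `ξ`;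
here `q` is the exponent conjugate to `r`, so that the `q`-norm is dual to the `r`-norm. -/
def objective (D : Problem m p Tini Tf T r) (q : ℝ≥0∞) (ε : ℝ)
    (ξ : Fin N → OutputData p Tini Tf T) (g : Fin (T / (Tini + Tf)) → ℝ) : ℝ :=
  D.f₁ (D.Uf *ᵥ g)
    + 1 / (N : ℝ) * ∑ i, (D.f₂ (futureRows (ξ i) *ᵥ g) + D.f₃ (pastRows (ξ i) *ᵥ g - D.yIni))
    + D.Lobj * ε * rNorm q g

/-- The constraints of the tractable problem in the variables `g`, `τ`, `s`. -/
def Feasible (D : Problem m p Tini Tf T r) (q : ℝ≥0∞) (ε : ℝ)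
    (ξ : Fin N → OutputData p Tini Tf T)
    (g : Fin (T / (Tini + Tf)) → ℝ) (τ : ℝ) (s : Fin N → ℝ) : Prop :=
  D.Up *ᵥ g = D.uIni ∧
  D.Uf *ᵥ g ∈ D.inputSet ∧
  -τ * D.α + D.Lcon * ε * rNorm q g + 1 / (N : ℝ) * ∑ i, s i ≤ 0 ∧
  (∀ i, τ + D.h (futureRows (ξ i) *ᵥ g) ≤ s i) ∧
  ∀ i, 0 ≤ s i

/-- `g` is (the `g`-component of) an optimizer of the tractable problem. -/
def IsOptimizer (D : Problem m p Tini Tf T r) (q : ℝ≥0∞) (ε : ℝ)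
    (ξ : Fin N → OutputData p Tini Tf T) (g : Fin (T / (Tini + Tf)) → ℝ) : Prop :=
  (∃ τ s, D.Feasible q ε ξ g τ s) ∧
  ∀ g' τ' s', D.Feasible q ε ξ g' τ' s' → D.objective q ε ξ g ≤ D.objective q ε ξ g'

end Problem

end DeePC

end

/-!
The statement has two halves: a concentration inequality for the empirical distribution in the
Wasserstein distance, with constants that depend only on the tail exponent, the dimension and the
exponential moment, and its consequence for the tractable problem.

**Concentration.** `transportCost_le_dyadic` bounds the Wasserstein distance by an explicit
functional, the weighted discrepancy `∑ w_Q |P(Q) - P_N(Q)|` over the dyadic cells `Q` of side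
lengths `1, 1/2, …, 2⁻ᴸ`, up to an error of order `2⁻ᴸ`. The coupling behind it matches, from the
finest cells to the coarsest, as much mass as possible inside each cell
(`exists_partial_coupling_nested`); the mass left in a cell is the difference of the two masses, and
the cell of twice the size is the next place to match it. The mass that is left in the cells of
side `1` is moved by a product measure, whence a weight for those cells that grows linearly with
the distance to the origin.

The discrepancy is a function of independent samples that changes by at most
`(W(ξᵢ) + W(ξ'ᵢ)) / N` if one sample is changed, where `W` grows linearly. As `P` has an exponential
moment of order `a > 1`, all `exp (s W)` are integrable, and integrating out one sample at a time
gives a Gaussian bound for the moment generating function (`lintegral_exp_mul_pi_le`), so that the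
discrepancy exceeds its mean by `ε / 2` with probability at most `exp (-c N ε²)` for `ε ≤ 1`. Its
mean is at most a constant times `2^{L (d - 2) / 2} / √N`: this is where `d ≥ 3` is used, as it makes
the finest level dominate (`lintegral_discrepancy_dyadic_le`). With `2⁻ᴸ` of order `ε` the mean is
at most `ε / 4` once `N ε^d` is large; if `N ε^d` is bounded, the claimed bound is trivial for a
large `c₁`. Since `ε² ≥ ε^d`, this settles `ε ≤ 1`. For large `ε` the Wasserstein distance is at
most `E ‖ξ‖` plus the mean of the `‖ξᵢ‖`, and Chernoff's bound for the mean of the `‖ξᵢ‖^a`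
suffices (`measure_transportCost_ge_le_of_large`); bounded `ε > 1` reduce to `ε = 1`.

**Guarantee.** The radius makes the bound equal to `β` (`wassersteinRadius_spec`). On the event that
the Wasserstein distance is less than the radius, integrating a Lipschitz function against a nearly
optimal coupling shows that its mean under `P` exceeds its sample mean by at most the Lipschitz
constant times the radius (`integral_le_of_transportCost_lt`). By Hölder's inequality the cost and
the constraint function are Lipschitz in the data with constants `Lobj ‖g‖_q` and `Lcon ‖g‖_q`,
which are the regularization terms of the tractable problem.
-/

/-! ### Transport through nested partitions -/

namespace DeePC

section Transport

variable {X I : Type*} [MeasurableSpace X] [MeasurableSpace I] [MeasurableSingletonClass I]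

/-- The optimal cost of transporting `μ` to `ν` for the cost function `c`: the infimum over the
couplings of `μ` and `ν`. -/
noncomputable def transportCost (c : X → X → ℝ≥0∞) (μ ν : Measure X) : ℝ≥0∞ :=
  ⨅ (γ : Measure (X × X)) (_ : γ.map Prod.fst = μ ∧ γ.map Prod.snd = ν), ∫⁻ z, c z.1 z.2 ∂γ

theorem transportCost_le {c : X → X → ℝ≥0∞} {μ ν : Measure X} {γ : Measure (X × X)}
    (h₁ : γ.map Prod.fst = μ) (h₂ : γ.map Prod.snd = ν) :
    transportCost c μ ν ≤ ∫⁻ z, c z.1 z.2 ∂γ :=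
  iInf₂_le γ ⟨h₁, h₂⟩

theorem transportCost_mono {c c' : X → X → ℝ≥0∞} (h : ∀ x y, c x y ≤ c' x y)
    (μ ν : Measure X) : transportCost c μ ν ≤ transportCost c' μ ν :=
  iInf₂_mono fun _ _ => lintegral_mono fun z => h z.1 z.2

/-- If the cost is at most `ρ x + ρ y`, transport by the independent coupling of two probability
measures shows that the transport cost is at most the sum of the integrals of `ρ`. -/
theorem transportCost_le_lintegral_add {c : X → X → ℝ≥0∞} {ρ : X → ℝ≥0∞} (hρ : Measurable ρ)
    (h : ∀ x y, c x y ≤ ρ x + ρ y) (μ ν : Measure X) [IsProbabilityMeasure μ]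
    [IsProbabilityMeasure ν] :
    transportCost c μ ν ≤ ∫⁻ x, ρ x ∂μ + ∫⁻ x, ρ x ∂ν := by
  refine (transportCost_le (γ := μ.prod ν) (by simp) (by simp)).trans ?_
  calc ∫⁻ z, c z.1 z.2 ∂(μ.prod ν) ≤ ∫⁻ z, (ρ z.1 + ρ z.2) ∂(μ.prod ν) :=
        lintegral_mono fun z => h z.1 z.2
    _ = ∫⁻ z, ρ z.1 ∂(μ.prod ν) + ∫⁻ z, ρ z.2 ∂(μ.prod ν) :=
        lintegral_add_left (hρ.comp measurable_fst) _
    _ = _ := by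
        rw [← lintegral_map hρ measurable_fst, ← lintegral_map hρ measurable_snd]
        simp

theorem sum_smul_restrict_fiber_apply {q : X → I} (hq : Measurable q) (μ : Measure X)
    (a : I → ℝ≥0∞) (j : I) :
    Measure.sum (fun i => a i • μ.restrict (q ⁻¹' {i})) (q ⁻¹' {j}) = a j * μ (q ⁻¹' {j}) := by
  rw [Measure.sum_apply _ (hq (measurableSet_singleton j)), tsum_eq_single j]
  · simp
  · intro i hij
    rw [Measure.smul_apply, Measure.restrict_apply (hq (measurableSet_singleton j))]
    have : q ⁻¹' {j} ∩ q ⁻¹' {i} = ∅ := by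
      ext x; simp only [Set.mem_inter_iff, Set.mem_preimage, Set.mem_singleton_iff,
        Set.mem_empty_iff_false, iff_false, not_and]
      rintro rfl h; exact hij h.symm
    simp [this]

theorem map_fst_apply_eq_map_snd_apply {q : X → I} (hq : Measurable q) {γ : Measure (X × X)}
    (h : ∀ᵐ z ∂γ, q z.1 = q z.2) (i : I) :
    γ.map Prod.fst (q ⁻¹' {i}) = γ.map Prod.snd (q ⁻¹' {i}) := by
  have hm := hq (measurableSet_singleton i)
  rw [Measure.map_apply measurable_fst hm, Measure.map_apply measurable_snd hm]
  refine measure_congr ?_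
  filter_upwards [h] with z hz
  change (q z.1 = i) = (q z.2 = i)
  rw [hz]

variable [Countable I]

theorem sum_restrict_fiber {q : X → I} (hq : Measurable q) (μ : Measure X) :
    Measure.sum (fun i => μ.restrict (q ⁻¹' {i})) = μ := by
  rw [← Measure.restrict_iUnion (fun i j hij => Set.disjoint_left.2 fun x hx hy =>
    hij (by simp_all)) fun i => hq (measurableSet_singleton i)]
  rw [show (⋃ i, q ⁻¹' {i}) = Set.univ by ext x; simp, Measure.restrict_univ]

theorem tsum_measure_fiber {q : X → I} (hq : Measurable q) (μ : Measure X) :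
    ∑' i, μ (q ⁻¹' {i}) = μ Set.univ := by
  conv_rhs => rw [← sum_restrict_fiber hq μ]
  rw [Measure.sum_apply _ MeasurableSet.univ]
  simp

theorem lintegral_comp_eq_tsum {q : X → I} (hq : Measurable q) (μ : Measure X) (w : I → ℝ≥0∞) :
    ∫⁻ x, w (q x) ∂μ = ∑' i, w i * μ (q ⁻¹' {i}) := by
  rw [← lintegral_map (measurable_of_countable w) hq, lintegral_countable']
  exact tsum_congr fun i => by rw [Measure.map_apply hq (measurableSet_singleton i)]

/-- A measure splits into the fraction `a i` of its mass in the fibre over `i` and the rest. -/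
theorem sum_smul_restrict_fiber_add {q : X → I} (hq : Measurable q) (μ : Measure X)
    {a : I → ℝ≥0∞} (ha : ∀ i, a i ≤ 1) :
    Measure.sum (fun i => a i • μ.restrict (q ⁻¹' {i}))
      + Measure.sum (fun i => (1 - a i) • μ.restrict (q ⁻¹' {i})) = μ := by
  rw [Measure.sum_add_sum]
  simp_rw [← add_smul, add_tsub_cancel_of_le (ha _), one_smul]
  exact sum_restrict_fiber hq μ

theorem inv_max_mul_le_one (x y : ℝ≥0∞) : (max x y)⁻¹ * y ≤ 1 :=
  (mul_le_mul_right (le_max_right x y) _).trans (ENNReal.inv_mul_le_one _)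

theorem one_sub_inv_max_mul_mul {x y : ℝ≥0∞} (hx : x ≠ ∞) (hy : y ≠ ∞) :
    (1 - (max x y)⁻¹ * y) * x = x - y := by
  rcases le_or_gt x y with h | h
  · rw [max_eq_right h, tsub_eq_zero_of_le h]
    rcases eq_or_ne y 0 with rfl | h0
    · simp [le_antisymm h zero_le]
    · simp [ENNReal.inv_mul_cancel h0 hy]
  · have hx0 : x ≠ 0 := (zero_le.trans_lt h).ne'
    rw [max_eq_left h.le, ENNReal.sub_mul (fun _ _ => hx), one_mul, mul_right_comm,
      ENNReal.inv_mul_cancel hx0 hx, one_mul]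

/-- A partial coupling that, in each fibre of `q`, matches as much mass of `μ` with mass of `ν` as
possible. Mass of only one of the two measures is left over in each fibre. -/
theorem exists_partial_coupling {q : X → I} (hq : Measurable q) (μ ν : Measure X)
    [IsFiniteMeasure μ] [IsFiniteMeasure ν] :
    ∃ (γ : Measure (X × X)) (μ' ν' : Measure X),
      γ.map Prod.fst + μ' = μ ∧ γ.map Prod.snd + ν' = ν ∧ (∀ᵐ z ∂γ, q z.1 = q z.2) ∧
      (∀ i, μ' (q ⁻¹' {i}) = μ (q ⁻¹' {i}) - ν (q ⁻¹' {i})) ∧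
      ∀ i, ν' (q ⁻¹' {i}) = ν (q ⁻¹' {i}) - μ (q ⁻¹' {i}) := by
  set M : I → ℝ≥0∞ := fun i => μ (q ⁻¹' {i})
  set V : I → ℝ≥0∞ := fun i => ν (q ⁻¹' {i})
  set γ : Measure (X × X) := Measure.sum fun i => (max (M i) (V i))⁻¹ •
    (μ.restrict (q ⁻¹' {i})).prod (ν.restrict (q ⁻¹' {i}))
  have h₁ : γ.map Prod.fst
      = Measure.sum fun i => ((max (M i) (V i))⁻¹ * V i) • μ.restrict (q ⁻¹' {i}) := by
    rw [Measure.map_sum measurable_fst.aemeasurable]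
    congr 1; ext1 i
    rw [Measure.map_smul, Measure.map_fst_prod, smul_smul, Measure.restrict_apply_univ]
  have h₂ : γ.map Prod.snd
      = Measure.sum fun i => ((max (V i) (M i))⁻¹ * M i) • ν.restrict (q ⁻¹' {i}) := by
    rw [Measure.map_sum measurable_snd.aemeasurable]
    congr 1; ext1 i
    rw [Measure.map_smul, Measure.map_snd_prod, smul_smul, Measure.restrict_apply_univ, max_comm]
  refine ⟨γ, Measure.sum fun i => (1 - (max (M i) (V i))⁻¹ * V i) • μ.restrict (q ⁻¹' {i}),
    Measure.sum fun i => (1 - (max (V i) (M i))⁻¹ * M i) • ν.restrict (q ⁻¹' {i}), ?_, ?_, ?_,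
    fun i => ?_, fun i => ?_⟩
  · rw [h₁, sum_smul_restrict_fiber_add hq μ fun i => inv_max_mul_le_one _ _]
  · rw [h₂, sum_smul_restrict_fiber_add hq ν fun i => inv_max_mul_le_one _ _]
  · rw [Measure.ae_sum_iff]
    refine fun i => Measure.ae_smul_measure ?_ _
    rw [Measure.prod_restrict]
    filter_upwards [ae_restrict_mem ((hq (measurableSet_singleton i)).prod
      (hq (measurableSet_singleton i)))] with z hz
    exact hz.1.trans hz.2.symm
  · rw [sum_smul_restrict_fiber_apply hq]
    exact one_sub_inv_max_mul_mul (measure_ne_top _ _) (measure_ne_top _ _)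
  · rw [sum_smul_restrict_fiber_apply hq]
    exact one_sub_inv_max_mul_mul (measure_ne_top _ _) (measure_ne_top _ _)

/-- Matching mass along a nested sequence of partitions, from the finest (number `l + k`) to
number `l`: what has to be matched in the cells of partition `l + j` is the mass that could not be
matched in the cells of partition `l + j + 1`. -/
theorem exists_partial_coupling_nested {q : ℕ → X → I} (hq : ∀ l, Measurable (q l))
    (hnest : ∀ l x y, q (l + 1) x = q (l + 1) y → q l x = q l y)
    {c : X → X → ℝ≥0∞} {δ : ℕ → ℝ≥0∞} (hc : ∀ l x y, q l x = q l y → c x y ≤ δ l)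
    (μ ν : Measure X) [IsFiniteMeasure μ] [IsFiniteMeasure ν] (k l : ℕ) :
    ∃ (γ : Measure (X × X)) (μ' ν' : Measure X),
      γ.map Prod.fst + μ' = μ ∧ γ.map Prod.snd + ν' = ν ∧ (∀ᵐ z ∂γ, q l z.1 = q l z.2) ∧
      (∀ i, μ' (q l ⁻¹' {i}) = μ (q l ⁻¹' {i}) - ν (q l ⁻¹' {i})) ∧
      (∀ i, ν' (q l ⁻¹' {i}) = ν (q l ⁻¹' {i}) - μ (q l ⁻¹' {i})) ∧
      ∫⁻ z, c z.1 z.2 ∂γ ≤ δ (l + k) * μ Set.univ + ∑ j ∈ Finset.range k,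
        δ (l + j) * ∑' i, (μ (q (l + j + 1) ⁻¹' {i}) - ν (q (l + j + 1) ⁻¹' {i})) := by
  have cost {γ : Measure (X × X)} {l : ℕ} {μ μ' : Measure X} (h : ∀ᵐ z ∂γ, q l z.1 = q l z.2)
      (hμ : γ.map Prod.fst + μ' = μ) : ∫⁻ z, c z.1 z.2 ∂γ ≤ δ l * μ Set.univ := by
    calc ∫⁻ z, c z.1 z.2 ∂γ ≤ ∫⁻ _, δ l ∂γ :=
          lintegral_mono_ae (h.mono fun z hz => hc l _ _ hz)
      _ = δ l * γ.map Prod.fst Set.univ := by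
          rw [lintegral_const, Measure.map_apply measurable_fst .univ, Set.preimage_univ]
      _ ≤ δ l * μ Set.univ := by
          gcongr; rw [← hμ]; exact Measure.le_add_right le_rfl
  induction k generalizing l with
  | zero =>
    obtain ⟨γ, μ', ν', h₁, h₂, h₃, h₄, h₅⟩ := exists_partial_coupling (hq l) μ ν
    exact ⟨γ, μ', ν', h₁, h₂, h₃, h₄, h₅, by simpa using cost h₃ h₁⟩
  | succ k ih =>
    obtain ⟨γ, μ', ν', h₁, h₂, h₃, h₄, h₅, h₆⟩ := ih (l + 1)
    have : IsFiniteMeasure μ' := isFiniteMeasure_of_le μ (h₁ ▸ Measure.le_add_left le_rfl)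
    have : IsFiniteMeasure ν' := isFiniteMeasure_of_le ν (h₂ ▸ Measure.le_add_left le_rfl)
    obtain ⟨γ', μ'', ν'', g₁, g₂, g₃, g₄, g₅⟩ := exists_partial_coupling (hq l) μ' ν'
    have h₃' : ∀ᵐ z ∂γ, q l z.1 = q l z.2 := h₃.mono fun z hz => hnest l _ _ hz
    -- what `γ` matches has the same mass in a cell for both measures, so it cancels
    have hfin (i) : γ.map Prod.snd (q l ⁻¹' {i}) ≠ ∞ :=
      ((h₂ ▸ Measure.le_add_right le_rfl : γ.map Prod.snd ≤ ν) _).trans_lt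
        (measure_lt_top ν _) |>.ne
    have hcell := map_fst_apply_eq_map_snd_apply (hq l) h₃'
    refine ⟨γ + γ', μ'', ν'', ?_, ?_, ?_, fun i => ?_, fun i => ?_, ?_⟩
    · rw [Measure.map_add _ _ measurable_fst, add_assoc, g₁, h₁]
    · rw [Measure.map_add _ _ measurable_snd, add_assoc, g₂, h₂]
    · rw [ae_add_measure_iff]; exact ⟨h₃', g₃⟩
    · rw [g₄, ← h₁, ← h₂, Measure.add_apply, Measure.add_apply, hcell,
        ENNReal.add_sub_add_eq_sub_left (hfin i)]
    · rw [g₅, ← h₁, ← h₂, Measure.add_apply, Measure.add_apply, hcell,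
        ENNReal.add_sub_add_eq_sub_left (hfin i)]
    · rw [lintegral_add_measure, Finset.sum_range_succ', ← add_assoc]
      refine add_le_add (h₆.trans_eq ?_) ((cost g₃ g₁).trans_eq ?_)
      · simp only [add_comm, add_left_comm]
      · rw [← tsum_measure_fiber (hq (l + 1)) μ']
        simp only [h₄, add_zero]

/-- The sum over the sets `B j` of the differences of mass, with weights `w j`. -/
noncomputable def discrepancy {J : Type*} (w : J → ℝ≥0∞) (B : J → Set X) (μ ν : Measure X) :
    ℝ≥0∞ :=
  ∑' j, w j * ((μ (B j) - ν (B j)) + (ν (B j) - μ (B j)))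

/-- The transport cost is bounded by the differences of mass in the cells of a nested sequence of
partitions. What cannot be matched in the cells of the coarsest partition is transported by a
product measure, at a cost that is bounded by a function of the cell. -/
theorem transportCost_le_discrepancy {q : ℕ → X → I} (hq : ∀ l, Measurable (q l))
    (hnest : ∀ l x y, q (l + 1) x = q (l + 1) y → q l x = q l y)
    {c : X → X → ℝ≥0∞} {δ : ℕ → ℝ≥0∞} (hc : ∀ l x y, q l x = q l y → c x y ≤ δ l)
    {w : I → ℝ≥0∞} (hw : ∀ x y, c x y ≤ w (q 0 x) + w (q 0 y))
    (μ ν : Measure X) [IsProbabilityMeasure μ] [IsProbabilityMeasure ν] (k : ℕ) :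
    transportCost c μ ν ≤ δ k + ∑ j ∈ Finset.range k,
        δ j * ∑' i, (μ (q (j + 1) ⁻¹' {i}) - ν (q (j + 1) ⁻¹' {i}))
      + discrepancy w (fun i => q 0 ⁻¹' {i}) μ ν := by
  obtain ⟨γ, μ', ν', h₁, h₂, -, h₄, h₅, h₆⟩ := exists_partial_coupling_nested hq hnest hc μ ν k 0
  have : IsFiniteMeasure μ' := isFiniteMeasure_of_le μ (h₁ ▸ Measure.le_add_left le_rfl)
  have : IsFiniteMeasure ν' := isFiniteMeasure_of_le ν (h₂ ▸ Measure.le_add_left le_rfl)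
  have hγ (f : X × X → X) (hf : Measurable f) : γ.map f Set.univ = γ Set.univ := by
    rw [Measure.map_apply hf .univ, Set.preimage_univ]
  have hγfin : γ Set.univ ≠ ∞ := by
    rw [← hγ _ measurable_fst]
    exact ((h₁ ▸ Measure.le_add_right le_rfl : γ.map Prod.fst ≤ μ) _).trans_lt
        (measure_lt_top μ _) |>.ne
  have hmass : μ' Set.univ = ν' Set.univ := by
    have e₁ : γ Set.univ + μ' Set.univ = 1 := by
      rw [← hγ _ measurable_fst, ← Measure.add_apply, h₁, measure_univ]
    have e₂ : γ Set.univ + ν' Set.univ = 1 := by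
      rw [← hγ _ measurable_snd, ← Measure.add_apply, h₂, measure_univ]
    exact (ENNReal.add_right_inj hγfin).1 (e₁.trans e₂.symm)
  set m := μ' Set.univ with hm
  have hmm (κ : Measure X) [IsFiniteMeasure κ] (hκ : κ Set.univ = m) : (m⁻¹ * m) • κ = κ := by
    rcases eq_or_ne m 0 with h0 | h0
    · rw [Measure.measure_univ_eq_zero.1 (hκ.trans h0), smul_zero]
    · rw [ENNReal.inv_mul_cancel h0 (measure_ne_top _ _), one_smul]
  have hf : (m⁻¹ • μ'.prod ν').map Prod.fst = μ' := by
    rw [Measure.map_smul, Measure.map_fst_prod, ← hmass, smul_smul, hmm μ' rfl]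
  have hs : (m⁻¹ • μ'.prod ν').map Prod.snd = ν' := by
    rw [Measure.map_smul, Measure.map_snd_prod, ← hm, smul_smul, hmm ν' hmass.symm]
  have hwm : Measurable fun x => w (q 0 x) := (measurable_of_countable w).comp (hq 0)
  refine (transportCost_le (γ := γ + m⁻¹ • μ'.prod ν') ?_ ?_).trans ?_
  · rw [Measure.map_add _ _ measurable_fst, hf, h₁]
  · rw [Measure.map_add _ _ measurable_snd, hs, h₂]
  · rw [lintegral_add_measure]
    refine add_le_add (by simpa using h₆) ?_
    calc ∫⁻ z, c z.1 z.2 ∂(m⁻¹ • μ'.prod ν')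
        ≤ ∫⁻ z, (w (q 0 z.1) + w (q 0 z.2)) ∂(m⁻¹ • μ'.prod ν') :=
          lintegral_mono fun z => hw _ _
      _ = ∫⁻ x, w (q 0 x) ∂μ' + ∫⁻ x, w (q 0 x) ∂ν' := by
          rw [lintegral_add_left (f := fun z : X × X => w (q 0 z.1)) (hwm.comp measurable_fst),
            ← lintegral_map (f := fun x => w (q 0 x)) hwm measurable_fst,
            ← lintegral_map (f := fun x => w (q 0 x)) hwm measurable_snd, hf, hs]
      _ = _ := by
          rw [lintegral_comp_eq_tsum (hq 0), lintegral_comp_eq_tsum (hq 0), ← ENNReal.tsum_add]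
          exact tsum_congr fun i => by rw [h₄, h₅, mul_add]

end Transport

/-! ### Exponential concentration for functions of independent samples -/

section Concentration

variable {X : Type*} [MeasurableSpace X]

theorem exp_le_one_add_add_sq_mul_exp_abs (s : ℝ) :
    Real.exp s ≤ 1 + s + s ^ 2 * Real.exp |s| := by
  have he : 1 ≤ Real.exp |s| := Real.one_le_exp (abs_nonneg s)
  rcases le_or_gt |s| 1 with h | h
  · have := (abs_le.1 (Real.abs_exp_sub_one_sub_id_le h)).2
    nlinarith [sq_nonneg s]
  · rcases le_or_gt 0 s with hs | hs
    · rw [abs_of_nonneg hs] at h he ⊢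
      nlinarith [mul_nonneg (sub_nonneg.2 (one_le_pow₀ h.le : 1 ≤ s ^ 2)) (Real.exp_pos s).le]
    · have h1 : Real.exp s ≤ 1 := Real.exp_le_one_iff.2 hs.le
      rw [abs_of_neg hs] at h he ⊢
      nlinarith [sq_nonneg s]

theorem integrable_exp_of_lintegral_le {P : Measure X} {u : X → ℝ} (hu : Measurable u) {K : ℝ}
    (hK : ∫⁻ x, ENNReal.ofReal (Real.exp (u x)) ∂P ≤ ENNReal.ofReal K) :
    Integrable (fun x => Real.exp (u x)) P := by
  refine ⟨hu.exp.aestronglyMeasurable, ?_⟩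
  rw [hasFiniteIntegral_iff_ofReal (ae_of_all _ fun x => (Real.exp_pos _).le)]
  exact hK.trans_lt ENNReal.ofReal_lt_top

theorem integrable_of_lintegral_exp_le {P : Measure X} {w : X → ℝ} (hw : Measurable w)
    (hw0 : ∀ x, 0 ≤ w x) {K : ℝ}
    (hK : ∫⁻ x, ENNReal.ofReal (Real.exp (2 * w x)) ∂P ≤ ENNReal.ofReal K) :
    Integrable w P := by
  refine (integrable_exp_of_lintegral_le (hw.const_mul 2) hK).mono' hw.aestronglyMeasurable
    (ae_of_all _ fun x => ?_)
  rw [Real.norm_of_nonneg (hw0 x)]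
  linarith [Real.add_one_le_exp (2 * w x), hw0 x]

/-- A function that oscillates by at most `w x + w y` has a Gaussian moment generating function
near zero if `w` has exponential moments. -/
theorem lintegral_exp_mul_le {P : Measure X} [IsProbabilityMeasure P] {w : X → ℝ}
    (hw : Measurable w) (hw0 : ∀ x, 0 ≤ w x) {K : ℝ}
    (hK : ∫⁻ x, ENNReal.ofReal (Real.exp (2 * w x)) ∂P ≤ ENNReal.ofReal K)
    {f : X → ℝ} (hf : Measurable f) (hfw : ∀ x y, |f x - f y| ≤ w x + w y)
    {t : ℝ} (ht0 : 0 ≤ t) (ht1 : t ≤ 1) :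
    Integrable f P ∧ ∫⁻ x, ENNReal.ofReal (Real.exp (t * f x)) ∂P
      ≤ ENNReal.ofReal (Real.exp (t * ∫ x, f x ∂P + t ^ 2 * (2 * K * Real.exp K))) := by
  have hexp := integrable_exp_of_lintegral_le (hw.const_mul 2) hK
  have hwi := integrable_of_lintegral_exp_le hw hw0 hK
  obtain ⟨x₀⟩ : Nonempty X := P.nonempty_of_neZero
  have hfi : Integrable f P := by
    refine (hwi.add (integrable_const (w x₀ + |f x₀|))).mono' hf.aestronglyMeasurable
      (ae_of_all _ fun x => ?_)
    have := hfw x x₀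
    have h2 := abs_sub_abs_le_abs_sub (f x) (f x₀)
    simp only [Real.norm_eq_abs, Pi.add_apply]
    linarith
  refine ⟨hfi, ?_⟩
  set m := ∫ x, f x ∂P
  set b := ∫ x, w x ∂P
  have hb0 : 0 ≤ b := integral_nonneg hw0
  have hexpK : ∫ x, Real.exp (2 * w x) ∂P ≤ max K 0 := by
    rw [integral_eq_lintegral_of_nonneg_ae (ae_of_all _ fun x => (Real.exp_pos _).le)
      hexp.aestronglyMeasurable]
    refine ENNReal.toReal_le_of_le_ofReal (le_max_right _ _) ?_
    simpa using hK
  have hexp1 : 1 + 2 * b ≤ ∫ x, Real.exp (2 * w x) ∂P := by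
    have : ∫ x, (1 + 2 * w x) ∂P = 1 + 2 * b := by
      rw [integral_add (integrable_const _) (hwi.const_mul 2), integral_const_mul]; simp [b]
    rw [← this]
    refine integral_mono ((integrable_const _).add (hwi.const_mul 2)) hexp fun x => ?_
    dsimp only
    linarith [Real.add_one_le_exp (2 * w x)]
  have hK1 : 1 ≤ K := by
    by_contra! h
    have := max_lt h one_pos
    linarith
  rw [max_eq_left (by linarith)] at hexpK
  have hdev (x : X) : |f x - m| ≤ w x + b := by
    have e : f x - m = ∫ y, (f x - f y) ∂P := by
      rw [integral_sub (integrable_const _) hfi]; simp [m]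
    have e' : ∫ y, (w x + w y) ∂P = w x + b := by
      rw [integral_add (integrable_const _) hwi]; simp [b]
    rw [e, ← e']
    exact (abs_integral_le_integral_abs).trans (integral_mono
      (((integrable_const _).sub hfi).abs) ((integrable_const _).add hwi) fun y => hfw x y)
  have hpt (x : X) : Real.exp (t * (f x - m)) ≤
      1 + t * (f x - m) + t ^ 2 * (2 * Real.exp (2 * b) * Real.exp (2 * w x)) := by
    refine (exp_le_one_add_add_sq_mul_exp_abs _).trans ?_
    have hu := hdev x
    set u := f x - m
    have h1 : |t * u| ≤ w x + b := by
      rw [abs_mul, abs_of_nonneg ht0]; nlinarith [abs_nonneg u]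
    have h2 : u ^ 2 ≤ 2 * Real.exp (w x + b) := by
      have := Real.quadratic_le_exp_of_nonneg (abs_nonneg u)
      have h3 := Real.exp_le_exp.2 hu
      rw [sq_abs] at this
      nlinarith [abs_nonneg u]
    have h4 : (t * u) ^ 2 * Real.exp |t * u|
        ≤ t ^ 2 * (2 * Real.exp (w x + b)) * Real.exp (w x + b) := by
      rw [mul_pow]
      gcongr
    have h5 : Real.exp (2 * b) * Real.exp (2 * w x)
        = Real.exp (w x + b) * Real.exp (w x + b) := by
      rw [← Real.exp_add, ← Real.exp_add]; ring_nf
    rw [mul_assoc 2, h5]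
    linarith
  have hint : ∫ x, (1 + t * (f x - m) + t ^ 2 * (2 * Real.exp (2 * b) * Real.exp (2 * w x))) ∂P
      ≤ Real.exp (t ^ 2 * (2 * K * Real.exp K)) := by
    have i1 : Integrable (fun x => t * (f x - m)) P := (hfi.sub (integrable_const _)).const_mul t
    have i2 : Integrable (fun x => t ^ 2 * (2 * Real.exp (2 * b) * Real.exp (2 * w x))) P :=
      (hexp.const_mul _).const_mul _
    rw [integral_add (f := fun x => 1 + t * (f x - m)) ((integrable_const _).add i1) i2,
      integral_add (integrable_const _) i1,
      integral_const_mul, integral_const_mul, integral_const_mul,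
      integral_sub hfi (integrable_const _)]
    have hz : ∫ x, f x ∂P - ∫ _, m ∂P = 0 := by simp [m]
    have ho : ∫ _ : X, (1 : ℝ) ∂P = 1 := by simp
    rw [hz, ho]
    have h6 : Real.exp (2 * b) ≤ Real.exp K := Real.exp_le_exp.2 (by linarith)
    have h7 : 2 * Real.exp (2 * b) * ∫ x, Real.exp (2 * w x) ∂P ≤ 2 * K * Real.exp K := by
      calc _ ≤ 2 * Real.exp K * K := by gcongr
        _ = _ := by ring
    have := Real.add_one_le_exp (t ^ 2 * (2 * K * Real.exp K))
    nlinarith [sq_nonneg t]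
  have hi : Integrable
      (fun x => 1 + t * (f x - m) + t ^ 2 * (2 * Real.exp (2 * b) * Real.exp (2 * w x))) P :=
    ((integrable_const _).add ((hfi.sub (integrable_const _)).const_mul t)).add
      ((hexp.const_mul _).const_mul _)
  calc ∫⁻ x, ENNReal.ofReal (Real.exp (t * f x)) ∂P
      = ∫⁻ x, ENNReal.ofReal (Real.exp (t * m)) *
          ENNReal.ofReal (Real.exp (t * (f x - m))) ∂P := by
        refine lintegral_congr fun x => ?_
        rw [← ENNReal.ofReal_mul (Real.exp_pos _).le, ← Real.exp_add]; ring_nf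
    _ = ENNReal.ofReal (Real.exp (t * m)) *
          ∫⁻ x, ENNReal.ofReal (Real.exp (t * (f x - m))) ∂P :=
        lintegral_const_mul _ (by fun_prop)
    _ ≤ ENNReal.ofReal (Real.exp (t * m)) *
          ENNReal.ofReal (Real.exp (t ^ 2 * (2 * K * Real.exp K))) := by
        gcongr
        refine (lintegral_mono fun x => ENNReal.ofReal_le_ofReal (hpt x)).trans ?_
        rw [← ofReal_integral_eq_lintegral_ofReal hi
          (ae_of_all _ fun x => (Real.exp_pos _).le.trans (hpt x))]
        exact ENNReal.ofReal_le_ofReal hint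
    _ = _ := by rw [← ENNReal.ofReal_mul (Real.exp_pos _).le, ← Real.exp_add]

/-- The moment generating function of a function of independent samples that changes by at most
`w x + w y` when a single sample `x` is replaced by `y`: the samples are integrated out one by
one. -/
theorem lintegral_exp_mul_pi_le {P : Measure X} [IsProbabilityMeasure P] {w : X → ℝ}
    (hw : Measurable w) (hw0 : ∀ x, 0 ≤ w x) {K : ℝ}
    (hK : ∫⁻ x, ENNReal.ofReal (Real.exp (2 * w x)) ∂P ≤ ENNReal.ofReal K)
    {t : ℝ} (ht0 : 0 ≤ t) (ht1 : t ≤ 1) (n : ℕ) {f : (Fin n → X) → ℝ} (hf : Measurable f)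
    (hfw : ∀ x i y, |f x - f (Function.update x i y)| ≤ w (x i) + w y) :
    Integrable f (Measure.pi fun _ => P) ∧
      ∫⁻ x, ENNReal.ofReal (Real.exp (t * f x)) ∂(Measure.pi fun _ => P)
        ≤ ENNReal.ofReal (Real.exp (t * ∫ x, f x ∂(Measure.pi fun _ => P)
            + n * (t ^ 2 * (2 * K * Real.exp K)))) := by
  induction n with
  | zero =>
    have hc : f = fun _ => f default := funext fun x => by rw [Subsingleton.elim x default]
    rw [hc]
    refine ⟨integrable_const _, ?_⟩
    simp
  | succ n ih =>
    have hmp := measurePreserving_piFinSuccAbove (fun _ : Fin (n + 1) => P) 0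
    set F : X × (Fin n → X) → ℝ :=
      fun z => f ((MeasurableEquiv.piFinSuccAbove (fun _ => X) 0).symm z) with hF
    have hFm : Measurable F := hf.comp (MeasurableEquiv.measurable _)
    have hFc (y : X) (x : Fin n → X) : F (y, x) = f (Fin.cons y x) := by
      simp [hF, MeasurableEquiv.piFinSuccAbove, Fin.insertNthEquiv]
    have hF1 (x : Fin n → X) (y y' : X) : |F (y, x) - F (y', x)| ≤ w y + w y' := by
      have := hfw (Fin.cons y x) 0 y'
      rwa [Fin.update_cons_zero, ← hFc, ← hFc] at this
    have hF2 (y : X) (x : Fin n → X) (i : Fin n) (x' : X) :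
        |F (y, x) - F (y, Function.update x i x')| ≤ w (x i) + w x' := by
      have := hfw (Fin.cons y x) i.succ x'
      rwa [← Fin.cons_update, ← hFc, ← hFc, Fin.cons_succ] at this
    have hone (x : Fin n → X) := lintegral_exp_mul_le hw hw0 hK
      (f := fun y => F (y, x)) (hFm.comp (by fun_prop)) (fun y y' => hF1 x y y') ht0 ht1
    have hwi := integrable_of_lintegral_exp_le hw hw0 hK
    set g : (Fin n → X) → ℝ := fun x => ∫ y, F (y, x) ∂P with hg
    have hgm : Measurable g :=
      (hFm.stronglyMeasurable.integral_prod_left' (μ := P)).measurable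
    have hgw (x : Fin n → X) (i : Fin n) (x' : X) :
        |g x - g (Function.update x i x')| ≤ w (x i) + w x' := by
      rw [hg, ← integral_sub (hone x).1 (hone _).1]
      refine abs_integral_le_integral_abs.trans ?_
      refine (integral_mono (((hone x).1.sub (hone _).1).abs) (integrable_const _)
        fun y => hF2 y x i x').trans ?_
      simp
    obtain ⟨y₀⟩ : Nonempty X := P.nonempty_of_neZero
    have h0 := (ih (f := fun x => F (y₀, x)) (hFm.comp (by fun_prop)) (hF2 y₀)).1
    have hFi : Integrable F (P.prod (Measure.pi fun _ => P)) := by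
      refine Integrable.mono' (g := fun z => w z.1 + (w y₀ + |F (y₀, z.2)|))
        (((hwi.comp_fst _).add ((integrable_const _).add (h0.abs.comp_snd _))))
        hFm.aestronglyMeasurable (ae_of_all _ fun z => ?_)
      have := hF1 z.2 z.1 y₀
      have h2 := abs_sub_abs_le_abs_sub (F z) (F (y₀, z.2))
      rw [Real.norm_eq_abs]
      linarith
    have hfF : f = fun x => F (MeasurableEquiv.piFinSuccAbove (fun _ => X) 0 x) := by
      ext x; simp only [hF, MeasurableEquiv.symm_apply_apply]
    have hfi : Integrable f (Measure.pi fun _ => P) := by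
      rw [hfF]; exact hmp.integrable_comp_of_integrable hFi
    refine ⟨hfi, ?_⟩
    have hfg : ∫ x, f x ∂(Measure.pi fun _ => P) = ∫ x, g x ∂(Measure.pi fun _ => P) := by
      rw [hfF, hmp.integral_comp (MeasurableEquiv.measurableEmbedding _) F]
      exact integral_prod_symm F hFi
    calc ∫⁻ x, ENNReal.ofReal (Real.exp (t * f x)) ∂(Measure.pi fun _ => P)
        = ∫⁻ z, ENNReal.ofReal (Real.exp (t * F z)) ∂(P.prod (Measure.pi fun _ => P)) := by
          rw [hfF]
          exact hmp.lintegral_comp (f := fun z => ENNReal.ofReal (Real.exp (t * F z)))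
            (by fun_prop)
      _ = ∫⁻ x, ∫⁻ y, ENNReal.ofReal (Real.exp (t * F (y, x))) ∂P ∂(Measure.pi fun _ => P) :=
          lintegral_prod_symm' _ (by fun_prop)
      _ ≤ ∫⁻ x, ENNReal.ofReal (Real.exp (t ^ 2 * (2 * K * Real.exp K))) *
            ENNReal.ofReal (Real.exp (t * g x)) ∂(Measure.pi fun _ => P) := by
          refine lintegral_mono fun x => (hone x).2.trans_eq ?_
          rw [← ENNReal.ofReal_mul (Real.exp_pos _).le, ← Real.exp_add, add_comm]
      _ = ENNReal.ofReal (Real.exp (t ^ 2 * (2 * K * Real.exp K))) *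
            ∫⁻ x, ENNReal.ofReal (Real.exp (t * g x)) ∂(Measure.pi fun _ => P) :=
          lintegral_const_mul _ (by fun_prop)
      _ ≤ ENNReal.ofReal (Real.exp (t ^ 2 * (2 * K * Real.exp K))) *
            ENNReal.ofReal (Real.exp (t * ∫ x, g x ∂(Measure.pi fun _ => P)
            + n * (t ^ 2 * (2 * K * Real.exp K)))) := by
          gcongr; exact (ih hgm hgw).2
      _ = _ := by
          rw [← ENNReal.ofReal_mul (Real.exp_pos _).le, ← Real.exp_add, hfg]
          congr 2; push_cast; ring

/-! ### The discrepancy of the empirical distribution -/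

theorem empirical_apply {N : ℕ} (ξ : Fin N → X) {B : Set X} (hB : MeasurableSet B) :
    empirical ξ B = (N : ℝ≥0∞)⁻¹ * ∑ i, B.indicator 1 (ξ i) := by
  simp [empirical, Measure.finsetSum_apply, hB]

theorem isProbabilityMeasure_empirical {N : ℕ} (hN : 1 ≤ N) (ξ : Fin N → X) :
    IsProbabilityMeasure (empirical ξ) := by
  constructor
  rw [empirical_apply ξ .univ]
  simp only [Set.indicator_univ, Pi.one_apply, Finset.sum_const, Finset.card_univ,
    Fintype.card_fin, nsmul_eq_mul, mul_one]
  exact ENNReal.inv_mul_cancel (by exact_mod_cast (by omega : N ≠ 0)) (by simp)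

theorem lintegral_empirical {N : ℕ} (ξ : Fin N → X) {f : X → ℝ≥0∞} (hf : Measurable f) :
    ∫⁻ x, f x ∂(empirical ξ) = (N : ℝ≥0∞)⁻¹ * ∑ i, f (ξ i) := by
  rw [empirical, lintegral_smul_measure, lintegral_finsetSum_measure]
  simp [lintegral_dirac' _ hf]

theorem empirical_le_add {N : ℕ} (ξ : Fin N → X) (i : Fin N) (y : X) :
    empirical ξ ≤ empirical (Function.update ξ i y) + (N : ℝ≥0∞)⁻¹ • Measure.dirac (ξ i) := by
  rw [empirical, empirical, ← smul_add]
  refine Measure.le_iff.2 fun s _ => ?_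
  rw [Measure.smul_apply, Measure.smul_apply, smul_eq_mul, smul_eq_mul]
  gcongr
  rw [← Finset.add_sum_erase _ _ (Finset.mem_univ i), add_comm,
    ← Finset.add_sum_erase _ (fun j => Measure.dirac (Function.update ξ i y j))
      (Finset.mem_univ i)]
  gcongr ?_ + _
  refine Measure.le_add_left (le_of_eq ?_)
  exact Finset.sum_congr rfl fun j hj => by
    rw [Function.update_of_ne (Finset.ne_of_mem_erase hj)]

theorem abs_diff_triangle {p x y z : ℝ≥0∞} (h₁ : x ≤ y + z) (h₂ : y ≤ x + z) :
    (p - x) + (x - p) ≤ (p - y) + (y - p) + z := by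
  rcases le_total p x with h | h
  · rw [tsub_eq_zero_of_le h, zero_add]
    calc x - p ≤ y + z - p := tsub_le_tsub_right h₁ p
      _ ≤ y - p + z := add_tsub_le_tsub_add
      _ ≤ _ := by gcongr; exact le_add_self
  · rw [tsub_eq_zero_of_le h, add_zero, tsub_le_iff_right]
    calc p ≤ p - y + y := le_tsub_add
      _ ≤ p - y + (x + z) := by gcongr
      _ ≤ (p - y) + (y - p) + (x + z) := by gcongr; exact le_self_add
      _ = _ := by ring

variable {J : Type*}

theorem discrepancy_le_add {w : J → ℝ≥0∞} {B : J → Set X} {P μ ν ρ : Measure X}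
    (h₁ : μ ≤ ν + ρ) (h₂ : ν ≤ μ + ρ) :
    discrepancy w B P μ ≤ discrepancy w B P ν + ∑' j, w j * ρ (B j) := by
  rw [discrepancy, discrepancy, ← ENNReal.tsum_add]
  refine ENNReal.tsum_le_tsum fun j => ?_
  rw [← mul_add]
  exact mul_le_mul_right (abs_diff_triangle (h₁ _) (h₂ _)) _

/-- Replacing one sample changes the discrepancy by at most the weights of the sets that contain
the old or the new sample, divided by the number of samples. -/
theorem discrepancy_empirical_le_add {w : J → ℝ≥0∞} {B : J → Set X}
    (hB : ∀ j, MeasurableSet (B j)) {P : Measure X} {N : ℕ} (ξ : Fin N → X) (i : Fin N) (y : X) :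
    discrepancy w B P (empirical ξ) ≤ discrepancy w B P (empirical (Function.update ξ i y))
      + (N : ℝ≥0∞)⁻¹ * (∑' j, w j * (B j).indicator 1 (ξ i) + ∑' j, w j * (B j).indicator 1 y) := by
  have h₂ : empirical (Function.update ξ i y)
      ≤ empirical ξ + (N : ℝ≥0∞)⁻¹ • Measure.dirac y := by
    simpa using empirical_le_add (Function.update ξ i y) i (ξ i)
  refine (discrepancy_le_add (ν := empirical (Function.update ξ i y))
    (ρ := (N : ℝ≥0∞)⁻¹ • Measure.dirac (ξ i) + (N : ℝ≥0∞)⁻¹ • Measure.dirac y) ?_ ?_).trans_eq ?_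
  · exact (empirical_le_add ξ i y).trans (by gcongr; exact Measure.le_add_right le_rfl)
  · exact h₂.trans (by gcongr; exact Measure.le_add_left le_rfl)
  · congr 1
    rw [← ENNReal.tsum_add, ← ENNReal.tsum_mul_left]
    refine tsum_congr fun j => ?_
    simp only [Measure.add_apply, Measure.smul_apply, Measure.dirac_apply' _ (hB j), smul_eq_mul]
    ring

theorem tsum_mul_empirical {w : J → ℝ≥0∞} {B : J → Set X}
    (hB : ∀ j, MeasurableSet (B j)) {N : ℕ} (ξ : Fin N → X) :
    ∑' j, w j * empirical ξ (B j)
      = (N : ℝ≥0∞)⁻¹ * ∑ i, ∑' j, w j * (B j).indicator 1 (ξ i) := by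
  rw [← Summable.tsum_finsetSum fun i _ => ENNReal.summable, ← ENNReal.tsum_mul_left]
  refine tsum_congr fun j => ?_
  rw [empirical_apply ξ (hB j), ← Finset.mul_sum]
  ring

theorem measurable_discrepancy_empirical [Countable J] {w : J → ℝ≥0∞} {B : J → Set X}
    (hB : ∀ j, MeasurableSet (B j)) (P : Measure X) (N : ℕ) :
    Measurable fun ξ : Fin N → X => discrepancy w B P (empirical ξ) := by
  refine Measurable.tsum fun j => ?_
  have : Measurable fun ξ : Fin N → X => empirical ξ (B j) := by
    simp_rw [fun ξ : Fin N → X => empirical_apply ξ (hB j)]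
    refine Measurable.const_mul (Finset.measurable_sum _ fun i _ => ?_) _
    exact (measurable_one.indicator (hB j)).comp (measurable_pi_apply i)
  exact (((measurable_const.sub this).add (this.sub measurable_const)).const_mul _)

/-- Chernoff's bound for the discrepancy of the empirical distribution, centred at an upper bound
`S` of its expectation. -/
theorem measure_discrepancy_empirical_ge_le [Countable J] {w : J → ℝ≥0∞} {B : J → Set X}
    (hB : ∀ j, MeasurableSet (B j)) {P : Measure X} [IsProbabilityMeasure P] {W : X → ℝ}
    (hWm : Measurable W) (hW0 : ∀ x, 0 ≤ W x)
    (hW : ∀ x, ∑' j, w j * (B j).indicator 1 x ≤ ENNReal.ofReal (W x)) {K : ℝ}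
    (hK : ∫⁻ x, ENNReal.ofReal (Real.exp (2 * W x)) ∂P ≤ ENNReal.ofReal K)
    {N : ℕ} (hN : 1 ≤ N) {S : ℝ} (hS0 : 0 ≤ S)
    (hS : ∫⁻ ξ, discrepancy w B P (empirical ξ) ∂(Measure.pi fun _ : Fin N => P)
      ≤ ENNReal.ofReal S)
    {s t : ℝ} (ht0 : 0 ≤ t) (ht1 : t ≤ 1) :
    Measure.pi (fun _ : Fin N => P)
        {ξ | ENNReal.ofReal (S + s) ≤ discrepancy w B P (empirical ξ)}
      ≤ ENNReal.ofReal (Real.exp (-(N * (t * s)) + N * (t ^ 2 * (2 * K * Real.exp K)))) := by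
  have hN0 : (0 : ℝ) < N := by exact_mod_cast hN
  have hNe : (N : ℝ≥0∞) ≠ 0 := by exact_mod_cast (by omega : N ≠ 0)
  have hDm := measurable_discrepancy_empirical (w := w) hB P N
  have hWi := integrable_of_lintegral_exp_le hWm hW0 hK
  set D : (Fin N → X) → ℝ≥0∞ := fun ξ => discrepancy w B P (empirical ξ) with hD
  have hWfin (x : X) : ∑' j, w j * (B j).indicator 1 x ≠ ∞ :=
    ((hW x).trans_lt ENNReal.ofReal_lt_top).ne
  have hPfin : ∑' j, w j * P (B j) ≠ ∞ := by
    have e : ∑' j, w j * P (B j) = ∫⁻ x, ∑' j, w j * (B j).indicator 1 x ∂P := by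
      rw [lintegral_tsum fun j =>
        ((measurable_one.indicator (hB j)).const_mul _).aemeasurable]
      refine tsum_congr fun j => ?_
      rw [lintegral_const_mul _ (measurable_one.indicator (hB j)), lintegral_indicator_one (hB j)]
    rw [e]
    refine ((lintegral_mono hW).trans_lt ?_).ne
    rw [← hasFiniteIntegral_iff_ofReal (ae_of_all _ hW0)]
    exact hWi.2
  have hDfin (ξ : Fin N → X) : D ξ ≠ ∞ := by
    refine ne_top_of_le_ne_top (b := ∑' j, w j * P (B j) + ∑' j, w j * empirical ξ (B j))
      (ENNReal.add_ne_top.2 ⟨hPfin, ?_⟩) ?_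
    · rw [tsum_mul_empirical hB]
      exact ENNReal.mul_ne_top (by simp [hNe]) (ENNReal.sum_ne_top.2 fun i _ => hWfin _)
    · rw [← ENNReal.tsum_add]
      refine ENNReal.tsum_le_tsum fun j => ?_
      rw [← mul_add]
      gcongr <;> exact tsub_le_self
  set f : (Fin N → X) → ℝ := fun ξ => N * (D ξ).toReal with hf
  have hfm : Measurable f := hDm.ennreal_toReal.const_mul _
  have hone (ξ : Fin N → X) (i : Fin N) (y : X) :
      f ξ ≤ f (Function.update ξ i y) + (W (ξ i) + W y) := by
    have h := discrepancy_empirical_le_add (w := w) hB (P := P) ξ i y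
    have h' : D ξ ≤ D (Function.update ξ i y)
        + (N : ℝ≥0∞)⁻¹ * (ENNReal.ofReal (W (ξ i)) + ENNReal.ofReal (W y)) :=
      h.trans (by gcongr <;> exact hW _)
    have hr : (D ξ).toReal ≤ (D (Function.update ξ i y)).toReal
        + (N : ℝ)⁻¹ * (W (ξ i) + W y) := by
      have hne : (N : ℝ≥0∞)⁻¹ * (ENNReal.ofReal (W (ξ i)) + ENNReal.ofReal (W y)) ≠ ∞ :=
        ENNReal.mul_ne_top (by simp [hNe]) (by simp)
      refine (ENNReal.toReal_mono (ENNReal.add_ne_top.2 ⟨hDfin _, hne⟩) h').trans_eq ?_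
      rw [ENNReal.toReal_add (hDfin _) hne, ENNReal.toReal_mul,
        ENNReal.toReal_add ENNReal.ofReal_ne_top ENNReal.ofReal_ne_top,
        ENNReal.toReal_ofReal (hW0 _), ENNReal.toReal_ofReal (hW0 _)]
      simp
    calc f ξ ≤ N * ((D (Function.update ξ i y)).toReal + (N : ℝ)⁻¹ * (W (ξ i) + W y)) := by
          simp only [hf]; gcongr
      _ = _ := by simp only [hf]; field_simp
  have hfw (ξ : Fin N → X) (i : Fin N) (y : X) :
      |f ξ - f (Function.update ξ i y)| ≤ W (ξ i) + W y := by
    have h1 := hone ξ i y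
    have h2 := hone (Function.update ξ i y) i (ξ i)
    simp only [Function.update_idem, Function.update_eq_self, Function.update_self] at h2
    rw [abs_le]; constructor <;> linarith
  have hmgf := (lintegral_exp_mul_pi_le hWm hW0 hK ht0 ht1 N hfm hfw).2
  have hmean : ∫ ξ, f ξ ∂(Measure.pi fun _ : Fin N => P) ≤ N * S := by
    rw [hf, integral_const_mul, integral_toReal hDm.aemeasurable
      (ae_of_all _ fun ξ => (hDfin ξ).lt_top)]
    gcongr
    exact ENNReal.toReal_le_of_le_ofReal hS0 hS
  set Z := ENNReal.ofReal (Real.exp (t * (N * (S + s)))) with hZ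
  have hZ0 : Z ≠ 0 := (ENNReal.ofReal_pos.2 (Real.exp_pos _)).ne'
  calc Measure.pi (fun _ : Fin N => P) {ξ | ENNReal.ofReal (S + s) ≤ D ξ}
      ≤ Measure.pi (fun _ : Fin N => P) {ξ | Z ≤ ENNReal.ofReal (Real.exp (t * f ξ))} := by
        refine measure_mono fun ξ hξ => ENNReal.ofReal_le_ofReal (Real.exp_le_exp.2 ?_)
        have := (ENNReal.ofReal_le_iff_le_toReal (hDfin ξ)).1 hξ
        simp only [hf]
        gcongr
    _ ≤ (∫⁻ ξ, ENNReal.ofReal (Real.exp (t * f ξ)) ∂(Measure.pi fun _ : Fin N => P)) / Z :=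
        meas_ge_le_lintegral_div (by fun_prop) hZ0 ENNReal.ofReal_ne_top
    _ ≤ ENNReal.ofReal (Real.exp (t * (N * S) + N * (t ^ 2 * (2 * K * Real.exp K)))) / Z := by
        gcongr
        exact hmgf.trans (by gcongr)
    _ = _ := by
        rw [hZ, ← ENNReal.ofReal_div_of_pos (Real.exp_pos _), ← Real.exp_sub]
        congr 2; ring

end Concentration

/-! ### Sums over the integer lattice -/

theorem tsum_int_exp_neg_le {θ : ℝ} (h0 : 0 < θ) (h1 : θ ≤ 1) :
    ∑' n : ℤ, ENNReal.ofReal (Real.exp (-(θ * |(n : ℝ)|))) ≤ ENNReal.ofReal (4 / θ) := by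
  set r := ENNReal.ofReal (Real.exp (-θ)) with hr
  have hpow (n : ℕ) : ENNReal.ofReal (Real.exp (-(θ * n))) = r ^ n := by
    rw [hr, ← ENNReal.ofReal_pow (Real.exp_pos _).le, ← Real.exp_nat_mul]; ring_nf
  have hr1 : r ≤ 1 := by
    rw [hr, ENNReal.ofReal_le_one]; exact Real.exp_le_one_iff.2 (by linarith)
  have hle : ∑' n : ℕ, r ^ (n + 1) ≤ (1 - r)⁻¹ := by
    rw [← ENNReal.tsum_geometric]
    exact ENNReal.tsum_le_tsum fun n => pow_le_pow_of_le_one zero_le hr1 n.le_succ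
  have hsum := HasSum.of_nat_of_neg_add_one
    (f := fun n : ℤ => ENNReal.ofReal (Real.exp (-(θ * |(n : ℝ)|))))
    (m := (1 - r)⁻¹) (m' := ∑' n : ℕ, r ^ (n + 1))
    (by
      simp only [Int.cast_natCast, Nat.abs_cast, hpow]
      rw [← ENNReal.tsum_geometric]; exact ENNReal.summable.hasSum)
    (by
      have (n : ℕ) : |((-((n : ℤ) + 1) : ℤ) : ℝ)| = ((n + 1 : ℕ) : ℝ) := by
        push_cast; rw [abs_neg, abs_of_nonneg (by positivity)]
      simp only [this, hpow]
      exact ENNReal.summable.hasSum)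
  rw [hsum.tsum_eq]
  refine (add_le_add_right hle _).trans ?_
  have hθ : θ / 2 ≤ 1 - Real.exp (-θ) := by
    have h2 : Real.exp (-θ) * Real.exp θ = 1 := by rw [← Real.exp_add]; simp
    have h3 := Real.add_one_le_exp θ
    nlinarith [Real.exp_pos (-θ)]
  have hinv : (1 - r)⁻¹ ≤ ENNReal.ofReal (2 / θ) := by
    rw [hr, ← ENNReal.ofReal_one, ← ENNReal.ofReal_sub _ (Real.exp_pos _).le,
      ← ENNReal.ofReal_inv_of_pos (by linarith)]
    refine ENNReal.ofReal_le_ofReal ?_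
    rw [← inv_div]
    exact inv_anti₀ (by positivity) hθ
  refine (add_le_add hinv hinv).trans_eq ?_
  rw [← ENNReal.ofReal_add (by positivity) (by positivity)]
  congr 1; ring

theorem tsum_fin_pi_prod (f : ℤ → ℝ≥0∞) (n : ℕ) :
    ∑' z : Fin n → ℤ, ∏ j, f (z j) = (∑' k, f k) ^ n := by
  induction n with
  | zero => simp
  | succ n ih =>
    rw [← (Fin.consEquiv fun _ => ℤ).tsum_eq, ENNReal.tsum_prod', pow_succ', ← ih,
      ← ENNReal.tsum_mul_right]
    refine tsum_congr fun k => ?_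
    rw [← ENNReal.tsum_mul_left]
    refine tsum_congr fun z => ?_
    simp [Fin.prod_univ_succ]

theorem tsum_pi_prod {ι : Type*} [Fintype ι] (f : ℤ → ℝ≥0∞) :
    ∑' z : ι → ℤ, ∏ j, f (z j) = (∑' k, f k) ^ Fintype.card ι := by
  rw [← tsum_fin_pi_prod f, ← ((Fintype.equivFin ι).arrowCongr (Equiv.refl ℤ)).symm.tsum_eq]
  refine tsum_congr fun z => ?_
  exact Fintype.prod_equiv (Fintype.equivFin ι) _ _ fun j => by simp

/-- The `1`-norm of an integer vector. -/
def latticeNorm {ι : Type*} [Fintype ι] (z : ι → ℤ) : ℝ := ∑ j, |(z j : ℝ)|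

theorem latticeNorm_nonneg {ι : Type*} [Fintype ι] (z : ι → ℤ) : 0 ≤ latticeNorm z :=
  Finset.sum_nonneg fun _ _ => abs_nonneg _

theorem tsum_exp_neg_latticeNorm_le {ι : Type*} [Fintype ι] {θ : ℝ} (h0 : 0 < θ) (h1 : θ ≤ 1) :
    ∑' z : ι → ℤ, ENNReal.ofReal (Real.exp (-(θ * latticeNorm z)))
      ≤ ENNReal.ofReal ((4 / θ) ^ Fintype.card ι) := by
  have (z : ι → ℤ) : ENNReal.ofReal (Real.exp (-(θ * latticeNorm z)))
      = ∏ j, ENNReal.ofReal (Real.exp (-(θ * |(z j : ℝ)|))) := by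
    rw [← ENNReal.ofReal_prod_of_nonneg fun _ _ => (Real.exp_pos _).le, ← Real.exp_sum,
      latticeNorm, Finset.mul_sum, Finset.sum_neg_distrib]
  simp_rw [this]
  rw [tsum_pi_prod fun n => ENNReal.ofReal (Real.exp (-(θ * |(n : ℝ)|))),
    ENNReal.ofReal_pow (by positivity)]
  gcongr
  exact tsum_int_exp_neg_le h0 h1

/-! ### Dyadic cells -/

section Cells

variable {X ι : Type*}

/-- The dyadic cell of side length `2⁻ˡ` that contains the point with coordinates `φ x`, given by
its integer corner in units of `2⁻ˡ`. -/
noncomputable def dyadicCell (φ : X → ι → ℝ) (l : ℕ) (x : X) : ι → ℤ := fun j => ⌊2 ^ l * φ x j⌋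

theorem measurable_dyadicCell [MeasurableSpace X] {φ : X → ι → ℝ} (hφ : Measurable φ) (l : ℕ) :
    Measurable (dyadicCell φ l) :=
  measurable_pi_lambda _ fun j =>
    (((measurable_pi_apply j).comp hφ).const_mul _).floor

theorem floor_eq_of_floor_two_mul_eq {s t : ℝ} (h : ⌊2 * s⌋ = ⌊2 * t⌋) : ⌊s⌋ = ⌊t⌋ := by
  have key {s t : ℝ} (h : ⌊2 * s⌋ = ⌊2 * t⌋) : ⌊s⌋ ≤ ⌊t⌋ := by
    rw [Int.le_floor]
    have h1 : 2 * ⌊s⌋ ≤ ⌊2 * s⌋ := by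
      rw [Int.le_floor]; push_cast; linarith [Int.floor_le s]
    rw [h, Int.le_floor] at h1
    push_cast at h1; linarith
  exact le_antisymm (key h) (key h.symm)

theorem dyadicCell_nested {φ : X → ι → ℝ} {l : ℕ} {x y : X}
    (h : dyadicCell φ (l + 1) x = dyadicCell φ (l + 1) y) : dyadicCell φ l x = dyadicCell φ l y := by
  ext j
  refine floor_eq_of_floor_two_mul_eq ?_
  have := congrFun h j
  simp only [dyadicCell, pow_succ'] at this
  simpa only [mul_assoc] using this

variable [Fintype ι]

theorem sum_abs_sub_le_of_dyadicCell_eq {φ : X → ι → ℝ} {l : ℕ} {x y : X}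
    (h : dyadicCell φ l x = dyadicCell φ l y) :
    ∑ j, |φ x j - φ y j| ≤ Fintype.card ι * (1 / 2) ^ l := by
  rw [← nsmul_eq_mul]
  refine Finset.sum_le_card_nsmul _ _ _ fun j _ => ?_
  have h1 := Int.abs_sub_lt_one_of_floor_eq_floor (congrFun h j)
  rw [← mul_sub, abs_mul, abs_of_pos (by positivity)] at h1
  rw [one_div_pow, le_div_iff₀ (by positivity)]
  linarith

theorem sum_abs_le_latticeNorm {φ : X → ι → ℝ} (x : X) :
    ∑ j, |φ x j| ≤ latticeNorm (dyadicCell φ 0 x) + Fintype.card ι := by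
  rw [latticeNorm, ← Finset.card_univ, ← nsmul_one, ← Finset.sum_const, ← Finset.sum_add_distrib]
  refine Finset.sum_le_sum fun j _ => ?_
  simp only [dyadicCell, pow_zero, one_mul]
  have h1 := Int.floor_le (φ x j)
  have h2 := Int.lt_floor_add_one (φ x j)
  have h3 := abs_sub_abs_le_abs_sub (φ x j) ⌊φ x j⌋
  rw [abs_of_nonneg (sub_nonneg.2 h1)] at h3
  linarith

theorem latticeNorm_dyadicCell_le {φ : X → ι → ℝ} {ρ : X → ℝ} (hρ : ∀ x j, |φ x j| ≤ ρ x)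
    (l : ℕ) (x : X) :
    (1 / 2) ^ l * latticeNorm (dyadicCell φ l x) ≤ Fintype.card ι * (ρ x + 1) := by
  rw [latticeNorm, Finset.mul_sum, ← nsmul_eq_mul]
  refine Finset.sum_le_card_nsmul _ _ _ fun j _ => ?_
  have h1 := Int.floor_le (2 ^ l * φ x j)
  have h2 := Int.lt_floor_add_one (2 ^ l * φ x j)
  have h3 := abs_sub_abs_le_abs_sub (⌊2 ^ l * φ x j⌋ : ℝ) (2 ^ l * φ x j)
  have h4 : |(⌊2 ^ l * φ x j⌋ : ℝ) - 2 ^ l * φ x j| ≤ 1 := by rw [abs_le]; constructor <;> linarith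
  rw [abs_mul, abs_of_pos (by positivity : (0 : ℝ) < 2 ^ l)] at h3
  have h5 : (1 : ℝ) ≤ 2 ^ l := one_le_pow₀ (by norm_num)
  rw [one_div_pow, one_div_mul_eq_div, div_le_iff₀ (by positivity)]
  simp only [dyadicCell]
  nlinarith [hρ x j]

/-! ### The dyadic discrepancy -/

/-- The weights of the dyadic cells of level `l`: the cost of moving mass out of a cell of side
length `1`, and for smaller cells twice the diameter of the cell. -/
noncomputable def dyadicWeight (ι : Type*) [Fintype ι] (L : ℕ) (j : Fin (L + 1) × (ι → ℤ)) : ℝ :=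
  if j.1 = 0 then latticeNorm j.2 + Fintype.card ι
  else 2 * Fintype.card ι * (1 / 2) ^ (j.1 : ℕ)

theorem dyadicWeight_nonneg (L : ℕ) (j : Fin (L + 1) × (ι → ℤ)) : 0 ≤ dyadicWeight ι L j := by
  have := latticeNorm_nonneg j.2
  unfold dyadicWeight; split_ifs <;> positivity

/-- The dyadic cells of levels `0, …, L`. -/
def dyadicSet (φ : X → ι → ℝ) (L : ℕ) (j : Fin (L + 1) × (ι → ℤ)) : Set X :=
  dyadicCell φ j.1 ⁻¹' {j.2}

theorem measurableSet_dyadicSet [MeasurableSpace X] {φ : X → ι → ℝ} (hφ : Measurable φ) (L : ℕ)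
    (j : Fin (L + 1) × (ι → ℤ)) : MeasurableSet (dyadicSet φ L j) :=
  measurable_dyadicCell hφ _ (measurableSet_singleton _)

/-- The transport cost for the `1`-norm is bounded by the diameter of the smallest dyadic cells and
the discrepancy of the two measures on the dyadic cells. -/
theorem transportCost_le_dyadic [MeasurableSpace X] {φ : X → ι → ℝ} (hφ : Measurable φ)
    (μ ν : Measure X) [IsProbabilityMeasure μ] [IsProbabilityMeasure ν] (L : ℕ) :
    transportCost (fun x y => ENNReal.ofReal (∑ j, |φ x j - φ y j|)) μ ν
      ≤ ENNReal.ofReal (Fintype.card ι * (1 / 2) ^ L)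
        + discrepancy (fun j => ENNReal.ofReal (dyadicWeight ι L j)) (dyadicSet φ L) μ ν := by
  refine (transportCost_le_discrepancy (measurable_dyadicCell hφ)
    (fun l x y => dyadicCell_nested)
    (δ := fun l => ENNReal.ofReal (Fintype.card ι * (1 / 2) ^ l))
    (w := fun z => ENNReal.ofReal (latticeNorm z + Fintype.card ι))
    (fun l x y h => ENNReal.ofReal_le_ofReal (sum_abs_sub_le_of_dyadicCell_eq h))
    (fun x y => ?_) μ ν L).trans ?_
  · rw [← ENNReal.ofReal_add (by have := latticeNorm_nonneg (dyadicCell φ 0 x); positivity)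
      (by have := latticeNorm_nonneg (dyadicCell φ 0 y); positivity)]
    refine ENNReal.ofReal_le_ofReal ?_
    refine le_trans ?_ (add_le_add (sum_abs_le_latticeNorm x) (sum_abs_le_latticeNorm y))
    rw [← Finset.sum_add_distrib]
    exact Finset.sum_le_sum fun j _ => abs_sub _ _
  · rw [add_assoc]
    refine add_le_add_right ?_ _
    rw [add_comm, discrepancy, discrepancy, ENNReal.tsum_prod',
      tsum_fintype (fun l : Fin (L + 1) => _), Fin.sum_univ_succ,
      ← Fin.sum_univ_eq_sum_range
        (fun j => ENNReal.ofReal (Fintype.card ι * (1 / 2) ^ j) *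
          ∑' i, (μ (dyadicCell φ (j + 1) ⁻¹' {i}) - ν (dyadicCell φ (j + 1) ⁻¹' {i})))]
    refine add_le_add (by simp [dyadicWeight, dyadicSet]) (Finset.sum_le_sum fun l _ => ?_)
    rw [← ENNReal.tsum_mul_left]
    refine ENNReal.tsum_le_tsum fun z => ?_
    have hw : dyadicWeight ι L (l.succ, z) = Fintype.card ι * (1 / 2) ^ (l : ℕ) := by
      simp only [dyadicWeight, Fin.succ_ne_zero, if_false, Fin.val_succ, pow_succ]; ring
    rw [hw]
    simp only [dyadicSet, Fin.val_succ]
    gcongr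
    exact le_self_add

theorem sum_range_half_le (n : ℕ) : ∑ l ∈ Finset.range n, (1 / 2 : ℝ) ^ l ≤ 2 := by
  have h := geom_sum_mul (1 / 2 : ℝ) n
  have : (0 : ℝ) ≤ (1 / 2) ^ n := by positivity
  linarith

/-- The weights of the dyadic cells that contain a given point. -/
theorem tsum_dyadicWeight_le {φ : X → ι → ℝ} {ρ : X → ℝ} (hρ : ∀ x j, |φ x j| ≤ ρ x)
    (L : ℕ) (x : X) :
    ∑' j, ENNReal.ofReal (dyadicWeight ι L j) * (dyadicSet φ L j).indicator 1 x
      ≤ ENNReal.ofReal (Fintype.card ι * (ρ x + 4)) := by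
  rw [ENNReal.tsum_prod', tsum_fintype]
  have (l : Fin (L + 1)) : ∑' z, ENNReal.ofReal (dyadicWeight ι L (l, z))
      * (dyadicSet φ L (l, z)).indicator 1 x
      = ENNReal.ofReal (dyadicWeight ι L (l, dyadicCell φ l x)) := by
    rw [tsum_eq_single (dyadicCell φ l x)]
    · simp [dyadicSet]
    · intro z hz
      rw [Set.indicator_of_notMem, mul_zero]
      exact fun h => hz (Eq.symm h)
  simp_rw [this]
  rw [← ENNReal.ofReal_sum_of_nonneg fun _ _ => dyadicWeight_nonneg _ _]
  refine ENNReal.ofReal_le_ofReal ?_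
  rw [Fin.sum_univ_succ]
  have h0 := latticeNorm_dyadicCell_le hρ 0 x
  have h1 : ∑ l : Fin L, dyadicWeight ι L (l.succ, dyadicCell φ l.succ x)
      ≤ Fintype.card ι * 2 := by
    have e (l : Fin L) : dyadicWeight ι L (l.succ, dyadicCell φ l.succ x)
        = Fintype.card ι * (1 / 2) ^ (l : ℕ) := by
      simp only [dyadicWeight, Fin.succ_ne_zero, if_false, Fin.val_succ, pow_succ]; ring
    simp_rw [e]
    rw [← Finset.mul_sum, Fin.sum_univ_eq_sum_range (fun l => (1 / 2 : ℝ) ^ l)]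
    gcongr
    exact sum_range_half_le L
  have h2 : dyadicWeight ι L (0, dyadicCell φ (0 : Fin (L + 1)) x)
      = latticeNorm (dyadicCell φ 0 x) + Fintype.card ι := by simp [dyadicWeight]
  rw [h2]
  simp only [pow_zero, one_mul] at h0
  linarith

theorem dyadicWeight_le [Nonempty ι] (L : ℕ) (l : Fin (L + 1)) (z : ι → ℤ) :
    dyadicWeight ι L (l, z)
      ≤ 2 * Fintype.card ι * (1 / 2) ^ (l : ℕ) * Real.exp ((1 / 2) ^ (l : ℕ) * latticeNorm z) := by
  have hz := latticeNorm_nonneg z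
  have hd : (1 : ℝ) ≤ Fintype.card ι := by exact_mod_cast Fintype.card_pos
  unfold dyadicWeight
  split_ifs with h
  · have h' : l = 0 := h
    subst h'
    have := Real.add_one_le_exp (latticeNorm z)
    simp only [Fin.val_zero, pow_zero, one_mul, mul_one]
    nlinarith
  · exact le_mul_of_one_le_right (by positivity) (Real.one_le_exp (by positivity))

/-! ### The expected discrepancy -/

/-- The mean deviation of the empirical mass of a set, by the inequality `2 |x| ≤ s x² + 1 / s`
and the variance of the binomial distribution. -/
theorem lintegral_abs_empirical_sub_le [MeasurableSpace X] (P : Measure X) [IsProbabilityMeasure P]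
    {B : Set X} (hB : MeasurableSet B) {N : ℕ} (hN : 1 ≤ N) {s : ℝ} (hs : 0 < s) :
    ∫⁻ ξ, ((P B - empirical ξ B) + (empirical ξ B - P B)) ∂(Measure.pi fun _ : Fin N => P)
      ≤ ENNReal.ofReal ((s * (P.real B / N) + 1 / s) / 2) := by
  have hN0 : (0 : ℝ) < N := by exact_mod_cast hN
  set φ : X → ℝ := B.indicator 1 with hφ
  have hφm : Measurable φ := measurable_one.indicator hB
  have hφ2 : MemLp φ 2 P := memLp_indicator_const 2 hB 1 (Or.inr (measure_ne_top _ _))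
  set p := P.real B with hp
  have hφint : ∫ x, φ x ∂P = p := integral_indicator_one hB
  set Y : (Fin N → X) → ℝ := ∑ i, fun ξ => φ (ξ i) with hY
  have hYm : Measurable Y := by
    have : Y = fun ξ => ∑ i, φ (ξ i) := by ext; simp [hY]
    rw [this]; exact Finset.measurable_sum _ fun i _ => hφm.comp (measurable_pi_apply i)
  have hcomp (i : Fin N) : MemLp (fun ξ : Fin N → X => φ (ξ i)) 2 (Measure.pi fun _ => P) :=
    hφ2.comp_measurePreserving (measurePreserving_eval (fun _ => P) i)
  have hY2 : MemLp Y 2 (Measure.pi fun _ : Fin N => P) := memLp_finsetSum' _ fun i _ => hcomp i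
  have hYmean : ∫ ξ, Y ξ ∂(Measure.pi fun _ : Fin N => P) = N * p := by
    simp only [hY, Finset.sum_apply]
    rw [integral_finsetSum _ fun i _ => (hcomp i).integrable one_le_two]
    have (i : Fin N) : ∫ ξ, φ (ξ i) ∂(Measure.pi fun _ : Fin N => P) = p := by
      rw [integral_comp_eval (μ := fun _ : Fin N => P) hφm.aestronglyMeasurable, hφint]
    simp [this]
  have hvar : ∫ ξ, (Y ξ - N * p) ^ 2 ∂(Measure.pi fun _ : Fin N => P) ≤ N * p := by
    have e := ProbabilityTheory.variance_eq_integral (μ := Measure.pi fun _ : Fin N => P)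
      hYm.aemeasurable
    rw [hYmean] at e
    rw [← e, hY, ProbabilityTheory.variance_sum_pi fun _ => hφ2]
    have : ProbabilityTheory.variance φ P ≤ p := by
      refine (ProbabilityTheory.variance_le_expectation_sq hφm.aestronglyMeasurable).trans_eq ?_
      rw [← hφint]
      refine integral_congr_ae (ae_of_all _ fun x => ?_)
      by_cases hx : x ∈ B <;> simp [hφ, hx]
    simp only [Finset.sum_const, Finset.card_univ, Fintype.card_fin, nsmul_eq_mul]
    gcongr
  have hφ0 (x : X) : 0 ≤ φ x := Set.indicator_nonneg (fun _ _ => zero_le_one) _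
  have hemp (ξ : Fin N → X) : empirical ξ B = ENNReal.ofReal (Y ξ / N) := by
    rw [empirical_apply ξ hB, ENNReal.ofReal_div_of_pos hN0, ENNReal.div_eq_inv_mul,
      ENNReal.ofReal_natCast, hY, Finset.sum_apply,
      ENNReal.ofReal_sum_of_nonneg fun i _ => hφ0 (ξ i)]
    congr 1
    refine Finset.sum_congr rfl fun i _ => ?_
    by_cases hx : ξ i ∈ B <;> simp [hφ, hx]
  have hY0 (ξ : Fin N → X) : 0 ≤ Y ξ := by
    simp only [hY, Finset.sum_apply]
    exact Finset.sum_nonneg fun i _ => hφ0 _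
  have hpt (ξ : Fin N → X) : (P B - empirical ξ B) + (empirical ξ B - P B)
      ≤ ENNReal.ofReal ((s / N ^ 2 * (Y ξ - N * p) ^ 2 + 1 / s) / 2) := by
    have habs : (P B - empirical ξ B) + (empirical ξ B - P B)
        = ENNReal.ofReal |p - Y ξ / N| := by
      have hPB : P B = ENNReal.ofReal p := (ofReal_measureReal (measure_ne_top _ _)).symm
      have hq : 0 ≤ Y ξ / N := div_nonneg (hY0 ξ) hN0.le
      rw [hemp, hPB, ← ENNReal.ofReal_sub _ hq, ← ENNReal.ofReal_sub _ measureReal_nonneg]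
      rcases le_total p (Y ξ / N) with h | h
      · rw [ENNReal.ofReal_of_nonpos (sub_nonpos.2 h), zero_add, abs_of_nonpos (sub_nonpos.2 h),
          neg_sub]
      · rw [ENNReal.ofReal_of_nonpos (sub_nonpos.2 h), add_zero, abs_of_nonneg (sub_nonneg.2 h)]
    rw [habs]
    refine ENNReal.ofReal_le_ofReal ?_
    have e : s / N ^ 2 * (Y ξ - N * p) ^ 2 = s * |p - Y ξ / N| ^ 2 := by
      rw [sq_abs]; field_simp; ring
    rw [e]
    set u := |p - Y ξ / N|
    have : s * u ^ 2 + 1 / s - 2 * u = (s * u - 1) ^ 2 / s := by field_simp; ring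
    have h2 : 0 ≤ (s * u - 1) ^ 2 / s := by positivity
    linarith
  have hint : Integrable (fun ξ => (Y ξ - N * p) ^ 2) (Measure.pi fun _ : Fin N => P) :=
    (hY2.sub (memLp_const _)).integrable_sq
  refine (lintegral_mono hpt).trans ?_
  rw [← ofReal_integral_eq_lintegral_ofReal
    (f := fun ξ => (s / N ^ 2 * (Y ξ - N * p) ^ 2 + 1 / s) / 2) (((hint.const_mul _).add (integrable_const _)).div_const 2)
    (ae_of_all _ fun ξ => by simp only [Pi.zero_apply]; positivity)]
  refine ENNReal.ofReal_le_ofReal ?_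
  rw [integral_div, integral_add (hint.const_mul _) (integrable_const _), integral_const_mul]
  simp only [integral_const, probReal_univ, smul_eq_mul, one_mul]
  have h : s / N ^ 2 * ∫ ξ, (Y ξ - N * p) ^ 2 ∂(Measure.pi fun _ : Fin N => P)
      ≤ s / N ^ 2 * (N * p) := by gcongr
  have h' : s / N ^ 2 * (N * p) = s * (p / N) := by field_simp
  linarith

end Cells

section Rate

variable {X ι : Type*} [Fintype ι] [MeasurableSpace X]

/-- The expected discrepancy on the dyadic cells of level `l`. The parameter `s` of
`lintegral_abs_empirical_sub_le` grows exponentially with the distance of the cell from the origin,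
so that both resulting sums over the cells converge: the first to an exponential moment of `P`, the
second to a geometric sum. -/
theorem tsum_dyadicWeight_mul_lintegral_le [Nonempty ι] {φ : X → ι → ℝ} (hφ : Measurable φ)
    {ρ : X → ℝ} (hρ : ∀ x j, |φ x j| ≤ ρ x) {P : Measure X} [IsProbabilityMeasure P] {K : ℝ}
    (hK0 : 0 ≤ K)
    (hK : ∫⁻ x, ENNReal.ofReal (Real.exp (3 * (Fintype.card ι * (ρ x + 1)))) ∂P
      ≤ ENNReal.ofReal K)
    {N : ℕ} (hN : 1 ≤ N) {L : ℕ} (l : Fin (L + 1)) {σ : ℝ} (hσ : 0 < σ) :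
    ∑' z, ENNReal.ofReal (dyadicWeight ι L (l, z)) *
        ∫⁻ ξ, ((P (dyadicSet φ L (l, z)) - empirical ξ (dyadicSet φ L (l, z)))
          + (empirical ξ (dyadicSet φ L (l, z)) - P (dyadicSet φ L (l, z))))
          ∂(Measure.pi fun _ : Fin N => P)
      ≤ ENNReal.ofReal (Fintype.card ι * (1 / 2) ^ (l : ℕ) *
          (σ * K / N + (4 * 2 ^ (l : ℕ)) ^ Fintype.card ι / σ)) := by
  set d := Fintype.card ι
  set θ : ℝ := (1 / 2) ^ (l : ℕ) with hθ
  have hθ0 : 0 < θ := by positivity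
  have hθ1 : θ ≤ 1 := pow_le_one₀ (by norm_num) (by norm_num)
  have hN0 : (0 : ℝ) < N := by exact_mod_cast hN
  have hterm (z : ι → ℤ) : ENNReal.ofReal (dyadicWeight ι L (l, z)) *
        ∫⁻ ξ, ((P (dyadicSet φ L (l, z)) - empirical ξ (dyadicSet φ L (l, z)))
          + (empirical ξ (dyadicSet φ L (l, z)) - P (dyadicSet φ L (l, z))))
          ∂(Measure.pi fun _ : Fin N => P)
      ≤ ENNReal.ofReal (d * θ * (σ / N)) * (ENNReal.ofReal (Real.exp (3 * (θ * latticeNorm z)))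
            * P (dyadicCell φ l ⁻¹' {z}))
        + ENNReal.ofReal (d * θ / σ) * ENNReal.ofReal (Real.exp (-(θ * latticeNorm z))) := by
    set u := θ * latticeNorm z
    have hs : 0 < σ * Real.exp (2 * u) := by positivity
    refine (mul_le_mul' (ENNReal.ofReal_le_ofReal (dyadicWeight_le L l z))
      (lintegral_abs_empirical_sub_le P (measurableSet_dyadicSet hφ L (l, z)) hN hs)).trans_eq ?_
    have hP : P (dyadicCell φ l ⁻¹' {z}) = ENNReal.ofReal (P.real (dyadicSet φ L (l, z))) :=
      (ofReal_measureReal (measure_ne_top _ _)).symm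
    rw [hP, ← ENNReal.ofReal_mul (by positivity), ← ENNReal.ofReal_mul (by positivity),
      ← ENNReal.ofReal_mul (by positivity), ← ENNReal.ofReal_mul (by positivity),
      ← ENNReal.ofReal_add (by positivity) (by positivity)]
    congr 1
    have e1 : Real.exp (3 * u) = Real.exp u * Real.exp (2 * u) := by
      rw [← Real.exp_add]; ring_nf
    have e2 : Real.exp (-u) = Real.exp u / Real.exp (2 * u) := by
      rw [← Real.exp_sub]; ring_nf
    rw [e1, e2]
    have := Real.exp_pos (2 * u)
    field_simp
    ring
  refine (ENNReal.tsum_le_tsum hterm).trans ?_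
  rw [ENNReal.tsum_add, ENNReal.tsum_mul_left, ENNReal.tsum_mul_left,
    ← lintegral_comp_eq_tsum (measurable_dyadicCell hφ l) P
      (fun z => ENNReal.ofReal (Real.exp (3 * (θ * latticeNorm z))))]
  have h1 : ∫⁻ x, ENNReal.ofReal (Real.exp (3 * (θ * latticeNorm (dyadicCell φ l x)))) ∂P
      ≤ ENNReal.ofReal K := by
    refine (lintegral_mono fun x => ENNReal.ofReal_le_ofReal (Real.exp_le_exp.2 ?_)).trans hK
    have := latticeNorm_dyadicCell_le hρ l x
    gcongr
  refine (add_le_add (mul_le_mul_right h1 _)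
    (mul_le_mul_right (tsum_exp_neg_latticeNorm_le hθ0 hθ1) _)).trans_eq ?_
  rw [← ENNReal.ofReal_mul (by positivity), ← ENNReal.ofReal_mul (by positivity),
    ← ENNReal.ofReal_add (by positivity) (by positivity)]
  congr 1
  have : 4 / θ = 4 * 2 ^ (l : ℕ) := by rw [hθ, one_div_pow]; field_simp
  rw [this]
  ring

theorem sum_range_pow_le {v : ℝ} (hv : 4 / 3 ≤ v) (L : ℕ) :
    ∑ l ∈ Finset.range (L + 1), v ^ l ≤ 4 * v ^ L := by
  induction L with
  | zero => simp
  | succ L ih =>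
    rw [Finset.sum_range_succ, pow_succ]
    have : 0 < v ^ L := by positivity
    nlinarith

/-- The expected dyadic discrepancy. In dimension `d ≥ 3` the sum over the levels is dominated by
the last one. -/
theorem lintegral_discrepancy_dyadic_le {φ : X → ι → ℝ} (hφ : Measurable φ)
    (hd : 3 ≤ Fintype.card ι)
    {ρ : X → ℝ} (hρ : ∀ x j, |φ x j| ≤ ρ x) {P : Measure X} [IsProbabilityMeasure P] {K : ℝ}
    (hK0 : 0 ≤ K)
    (hK : ∫⁻ x, ENNReal.ofReal (Real.exp (3 * (Fintype.card ι * (ρ x + 1)))) ∂P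
      ≤ ENNReal.ofReal K)
    {N : ℕ} (hN : 1 ≤ N) (L : ℕ) :
    ∫⁻ ξ, discrepancy (fun j => ENNReal.ofReal (dyadicWeight ι L j)) (dyadicSet φ L) P
        (empirical ξ) ∂(Measure.pi fun _ : Fin N => P)
      ≤ ENNReal.ofReal (4 * Fintype.card ι * (K + 4 ^ Fintype.card ι) *
          ((√2 ^ (Fintype.card ι - 2)) ^ L / √N)) := by
  set d := Fintype.card ι with hd'
  have : Nonempty ι := Fintype.card_pos_iff.1 (by omega)
  have hN0 : (0 : ℝ) < N := by exact_mod_cast hN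
  have hB := measurableSet_dyadicSet hφ L
  have hmeas (j : Fin (L + 1) × (ι → ℤ)) : Measurable fun ξ : Fin N → X =>
      (P (dyadicSet φ L j) - empirical ξ (dyadicSet φ L j))
        + (empirical ξ (dyadicSet φ L j) - P (dyadicSet φ L j)) := by
    have := measurable_discrepancy_empirical (J := Unit) (w := fun _ => 1)
      (B := fun _ => dyadicSet φ L j) (fun _ => hB j) P N
    simpa [discrepancy] using this
  simp only [discrepancy]
  rw [lintegral_tsum fun j => ((hmeas j).const_mul _).aemeasurable, ENNReal.tsum_prod',
    tsum_fintype (fun l : Fin (L + 1) => _)]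
  have hlevel (l : Fin (L + 1)) : ∑' z, ∫⁻ ξ, ENNReal.ofReal (dyadicWeight ι L (l, z)) *
      ((P (dyadicSet φ L (l, z)) - empirical ξ (dyadicSet φ L (l, z)))
          + (empirical ξ (dyadicSet φ L (l, z)) - P (dyadicSet φ L (l, z))))
          ∂(Measure.pi fun _ : Fin N => P)
      ≤ ENNReal.ofReal (d * (K + 4 ^ d) / √N * (√2 ^ (d - 2)) ^ (l : ℕ)) := by
    rw [tsum_congr fun z => lintegral_const_mul (ENNReal.ofReal (dyadicWeight ι L (l, z)))
      (hmeas (l, z))]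
    -- this choice of `σ` balances the two terms of the bound for level `l`
    have hσ : 0 < √N * (√2 ^ d) ^ (l : ℕ) := by positivity
    refine (tsum_dyadicWeight_mul_lintegral_le hφ hρ hK0 hK hN l hσ).trans_eq ?_
    congr 1
    obtain ⟨e, he⟩ : ∃ e, d = e + 2 := ⟨d - 2, by omega⟩
    rw [← hd', he, Nat.add_sub_cancel]
    have hN2 : (N : ℝ) = √N ^ 2 := (Real.sq_sqrt hN0.le).symm
    have hs2 : (2 : ℝ) = √2 ^ 2 := (Real.sq_sqrt (by norm_num)).symm
    set n : ℝ := √N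
    set t : ℝ := √2
    have hn : 0 < n := Real.sqrt_pos.2 hN0
    have ht : 0 < t := Real.sqrt_pos.2 (by norm_num)
    have h4 : ((4 : ℝ) * 2 ^ (l : ℕ)) ^ (e + 2)
        = 4 ^ (e + 2) * (t ^ (e + 2)) ^ (l : ℕ) * (t ^ (e + 2)) ^ (l : ℕ) := by
      have : (2 : ℝ) ^ (l : ℕ) = (t ^ (l : ℕ)) ^ 2 := by
        rw [← pow_mul, mul_comm, pow_mul, ← hs2]
      rw [this]; ring
    have h5 : (1 / 2 : ℝ) ^ (l : ℕ) = 1 / (t ^ 2) ^ (l : ℕ) := by rw [← hs2, one_div_pow]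
    have h6 : (t ^ (e + 2)) ^ (l : ℕ) = (t ^ e) ^ (l : ℕ) * (t ^ 2) ^ (l : ℕ) := by
      rw [← mul_pow, ← pow_add]
    rw [h4, h5, hN2, h6]
    have h7 : 0 < (t ^ e) ^ (l : ℕ) := by positivity
    have h8 : 0 < (t ^ 2) ^ (l : ℕ) := by positivity
    generalize (t ^ e) ^ (l : ℕ) = A at *
    generalize (t ^ 2) ^ (l : ℕ) = B at *
    field_simp
  refine (Finset.sum_le_sum fun l _ => hlevel l).trans ?_
  rw [← ENNReal.ofReal_sum_of_nonneg fun _ _ => by positivity]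
  refine ENNReal.ofReal_le_ofReal ?_
  rw [← Finset.mul_sum, Fin.sum_univ_eq_sum_range (fun l => (√2 ^ (d - 2)) ^ l)]
  have hv : (4 / 3 : ℝ) ≤ √2 ^ (d - 2) := by
    have h1 : (4 / 3 : ℝ) ≤ √2 := Real.le_sqrt_of_sq_le (by norm_num)
    exact h1.trans (le_self_pow₀ (by linarith) (by omega))
  calc d * (K + 4 ^ d) / √N * ∑ l ∈ Finset.range (L + 1), (√2 ^ (d - 2)) ^ l
      ≤ d * (K + 4 ^ d) / √N * (4 * (√2 ^ (d - 2)) ^ L) := by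
        gcongr; exact sum_range_pow_le hv L
    _ = _ := by ring

/-- Concentration of the empirical distribution at small scales `ε`, provided that there are
enough samples. -/
theorem measure_transportCost_ge_le {φ : X → ι → ℝ} (hφ : Measurable φ) (hd : 3 ≤ Fintype.card ι)
    {ρ : X → ℝ} (hρm : Measurable ρ) (hρ : ∀ x j, |φ x j| ≤ ρ x) {P : Measure X}
    [IsProbabilityMeasure P] {K : ℝ} (hK1 : 1 ≤ K)
    (hK : ∫⁻ x, ENNReal.ofReal (Real.exp (3 * (Fintype.card ι * (ρ x + 4)))) ∂P
      ≤ ENNReal.ofReal K)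
    {N : ℕ} (hN : 1 ≤ N) {ε : ℝ} (hε : 0 < ε) (hε1 : ε ≤ 1)
    (hNε : (16 * Fintype.card ι * (K + 4 ^ Fintype.card ι)) ^ 2 *
      (8 * Fintype.card ι) ^ (Fintype.card ι - 2) ≤ N * ε ^ Fintype.card ι) :
    Measure.pi (fun _ : Fin N => P) {ξ | ENNReal.ofReal ε ≤
        transportCost (fun x y => ENNReal.ofReal (∑ j, |φ x j - φ y j|)) P (empirical ξ)}
      ≤ ENNReal.ofReal (Real.exp (-(N * ε ^ 2 / (32 * (K * Real.exp K))))) := by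
  set d := Fintype.card ι with hd'
  have hd3 : (3 : ℝ) ≤ d := by exact_mod_cast hd
  have : Nonempty ι := Fintype.card_pos_iff.1 (by omega)
  have hN0 : (0 : ℝ) < N := by exact_mod_cast hN
  have hρ0 (x : X) : 0 ≤ ρ x := (abs_nonneg _).trans (hρ x (Classical.arbitrary ι))
  -- the finest dyadic level has cells of diameter comparable to `ε`
  obtain ⟨L, hL1, hL2⟩ : ∃ L : ℕ, d * (1 / 2) ^ L ≤ ε / 4 ∧ (2 : ℝ) ^ L ≤ 8 * d / ε := by
    obtain ⟨n, h1, h2⟩ := exists_nat_pow_near (x := 4 * d / ε) (y := 2)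
      (by rw [le_div_iff₀ hε]; linarith) (by norm_num)
    refine ⟨n + 1, ?_, ?_⟩
    · rw [one_div_pow, mul_one_div, div_le_iff₀ (by positivity)]
      rw [div_lt_iff₀ hε] at h2
      linarith
    · rw [pow_succ]
      calc (2 : ℝ) ^ n * 2 ≤ 4 * d / ε * 2 := by gcongr
        _ = 8 * d / ε := by ring
  set S : ℝ := 4 * d * (K + 4 ^ d) * ((√2 ^ (d - 2)) ^ L / √N) with hSdef
  have hS0 : 0 ≤ S := by positivity
  have hS4 : S ≤ ε / 4 := by
    refine abs_le_of_sq_le_sq' ?_ (by positivity) |>.2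
    have e1 : ((√2 ^ (d - 2)) ^ L) ^ 2 = (2 ^ L) ^ (d - 2) := by
      rw [← pow_mul, ← pow_mul, show (d - 2) * (L * 2) = 2 * (L * (d - 2)) by ring, pow_mul,
        Real.sq_sqrt (by norm_num), pow_mul]
    have e2 : S ^ 2 = (4 * d * (K + 4 ^ d)) ^ 2 * ((2 ^ L) ^ (d - 2) / N) := by
      rw [hSdef, mul_pow, div_pow, e1, Real.sq_sqrt hN0.le]
    rw [e2]
    have e3 : ((2 : ℝ) ^ L) ^ (d - 2) ≤ (8 * d / ε) ^ (d - 2) := by gcongr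
    calc (4 * d * (K + 4 ^ d)) ^ 2 * ((2 ^ L) ^ (d - 2) / N)
        ≤ (4 * d * (K + 4 ^ d)) ^ 2 * ((8 * d / ε) ^ (d - 2) / N) := by gcongr
      _ = ((16 * d * (K + 4 ^ d)) ^ 2 * (8 * d) ^ (d - 2)) / (16 * N * ε ^ (d - 2)) := by
          rw [div_pow]; field_simp; ring
      _ ≤ (N * ε ^ d) / (16 * N * ε ^ (d - 2)) := by gcongr
      _ = (ε / 4) ^ 2 := by
          obtain ⟨e, he⟩ : ∃ e, d = e + 2 := ⟨d - 2, by omega⟩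
          rw [he, Nat.add_sub_cancel]; field_simp; ring
  have hS := lintegral_discrepancy_dyadic_le hφ hd hρ (by linarith : 0 ≤ K)
    ((lintegral_mono fun x => ENNReal.ofReal_le_ofReal (Real.exp_le_exp.2 (by gcongr; norm_num))).trans
      hK) hN L
  have hKe : 1 ≤ K * Real.exp K := one_le_mul_of_one_le_of_one_le hK1 (Real.one_le_exp (by linarith))
  have hmain := measure_discrepancy_empirical_ge_le (measurableSet_dyadicSet hφ L) (P := P)
    (W := fun x => d * (ρ x + 4)) (by fun_prop) (fun x => by have := hρ0 x; positivity)
    (tsum_dyadicWeight_le hρ L) (K := K)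
    ((lintegral_mono fun x => ENNReal.ofReal_le_ofReal (Real.exp_le_exp.2 (by
      have := hρ0 x; gcongr; norm_num))).trans hK) hN hS0 hS
    (s := ε / 2) (t := ε / (8 * (K * Real.exp K))) (by positivity)
    (by rw [div_le_one (by positivity)]; linarith)
  refine (measure_mono fun ξ hξ => ?_).trans (hmain.trans (ENNReal.ofReal_le_ofReal
    (Real.exp_le_exp.2 (le_of_eq ?_))))
  · have := isProbabilityMeasure_empirical hN ξ
    have h1 := hξ.out.trans ((transportCost_le_dyadic hφ P (empirical ξ) L).trans
      (add_le_add_left (ENNReal.ofReal_le_ofReal hL1) _))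
    have h2 : ENNReal.ofReal ε = ENNReal.ofReal (ε / 4) + ENNReal.ofReal (3 * ε / 4) := by
      rw [← ENNReal.ofReal_add (by positivity) (by positivity)]; congr 1; ring
    rw [h2, ENNReal.add_le_add_iff_left ENNReal.ofReal_ne_top] at h1
    exact (ENNReal.ofReal_le_ofReal (by linarith)).trans h1
  · field_simp
    ring

end Rate
/-! ### Concentration at large scales, and choice of the constants -/

theorem mul_le_rpow_add_rpow {a : ℝ} (ha : 1 < a) {s x : ℝ} (hs : 0 ≤ s) (hx : 0 ≤ x) :
    s * x ≤ x ^ a + s ^ (a / (a - 1)) := by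
  have ha1 : 0 < a - 1 := by linarith
  rcases le_total s (x ^ (a - 1)) with h | h
  · have h1 : s * x ≤ x ^ a := by
      calc s * x ≤ x ^ (a - 1) * x := by gcongr
        _ ≤ x ^ a := by
          rcases hx.eq_or_lt with rfl | hx'
          · rw [mul_zero]; positivity
          · rw [← Real.rpow_add_one hx'.ne']; simp
    have := Real.rpow_nonneg hs (a / (a - 1))
    linarith
  · have h1 : x ≤ s ^ (1 / (a - 1)) := by
      rw [one_div, Real.le_rpow_inv_iff_of_pos hx hs ha1]; exact h
    have h2 : s * x ≤ s ^ (a / (a - 1)) := by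
      rcases hs.eq_or_lt with rfl | hs'
      · rw [zero_mul]; positivity
      · calc s * x ≤ s * s ^ (1 / (a - 1)) := by gcongr
          _ = s ^ (a / (a - 1)) := by
            rw [mul_comm, ← Real.rpow_add_one hs'.ne']; congr 1; field_simp; ring
    have := Real.rpow_nonneg hx a
    linarith

theorem le_exp_rpow {a : ℝ} (ha : 1 ≤ a) {x : ℝ} (hx : 0 ≤ x) : x ≤ Real.exp (x ^ a) := by
  rcases le_total x 1 with h | h
  · exact h.trans (Real.one_le_exp (by positivity))
  · calc x = x ^ (1 : ℝ) := (Real.rpow_one x).symm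
      _ ≤ x ^ a := Real.rpow_le_rpow_of_exponent_le h ha
      _ ≤ Real.exp (x ^ a) := by linarith [Real.add_one_le_exp (x ^ a)]

theorem lintegral_exp_mul_add_le {X : Type*} [MeasurableSpace X] {P : Measure X} {a : ℝ}
    (ha : 1 < a) {ρ : X → ℝ} (hρm : Measurable ρ) (hρ0 : ∀ x, 0 ≤ ρ x) {M : ℝ}
    (hM : ∫⁻ x, ENNReal.ofReal (Real.exp (ρ x ^ a)) ∂P ≤ ENNReal.ofReal M) {s : ℝ} (hs : 0 ≤ s)
    (b : ℝ) :
    ∫⁻ x, ENNReal.ofReal (Real.exp (s * ρ x + b)) ∂P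
      ≤ ENNReal.ofReal (Real.exp (s ^ (a / (a - 1)) + b) * M) := by
  rw [ENNReal.ofReal_mul (Real.exp_pos _).le]
  refine le_trans ?_ (mul_le_mul_right hM _)
  rw [← lintegral_const_mul _ (by fun_prop)]
  refine lintegral_mono fun x => ?_
  rw [← ENNReal.ofReal_mul (Real.exp_pos _).le, ← Real.exp_add]
  refine ENNReal.ofReal_le_ofReal (Real.exp_le_exp.2 ?_)
  linarith [mul_le_rpow_add_rpow ha hs (hρ0 x)]

/-- At large scales `ε` the transport cost is compared with that of moving all the mass through
the origin, so that Chernoff's bound for the mean of the `ρ (ξ i) ^ a` applies. -/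
theorem measure_transportCost_ge_le_of_large {X : Type*} [MeasurableSpace X] {P : Measure X}
    [IsProbabilityMeasure P] {a : ℝ} (ha : 1 < a) {ρ : X → ℝ} (hρm : Measurable ρ)
    (hρ0 : ∀ x, 0 ≤ ρ x) {c : X → X → ℝ≥0∞} (hc : ∀ x y, c x y ≤ ENNReal.ofReal (ρ x + ρ y))
    {M : ℝ} (hM1 : 1 ≤ M) (hM : ∫⁻ x, ENNReal.ofReal (Real.exp (ρ x ^ a)) ∂P ≤ ENNReal.ofReal M)
    {N : ℕ} (hN : 1 ≤ N) {ε : ℝ} (hε : 4 * M ≤ ε) :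
    Measure.pi (fun _ : Fin N => P)
        {ξ | ENNReal.ofReal ε ≤ transportCost c P (empirical ξ)}
      ≤ ENNReal.ofReal (Real.exp (-(N * ((ε / 2) ^ a / 2)))) := by
  have hN0 : (0 : ℝ) < N := by exact_mod_cast hN
  have hε0 : 0 < ε := by linarith
  set f : X → ℝ := fun x => Real.exp (ρ x ^ a) with hf
  have hfm : Measurable fun x => ρ x ^ a := by fun_prop
  have hfi : Integrable f P := integrable_exp_of_lintegral_le hfm hM
  have hfM : ∫ x, f x ∂P ≤ M := by
    rw [integral_eq_lintegral_of_nonneg_ae (ae_of_all _ fun x => (Real.exp_pos _).le)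
      hfi.aestronglyMeasurable]
    exact ENNReal.toReal_le_of_le_ofReal (by linarith) hM
  have hf0 : 0 ≤ ∫ x, f x ∂P := integral_nonneg fun x => (Real.exp_pos _).le
  have hρM : ∫⁻ x, ENNReal.ofReal (ρ x) ∂P ≤ ENNReal.ofReal M :=
    (lintegral_mono fun x => ENNReal.ofReal_le_ofReal (le_exp_rpow ha.le (hρ0 x))).trans hM
  set Z := ENNReal.ofReal (Real.exp (N * (ε / 2) ^ a)) with hZ
  have hsub : {ξ | ENNReal.ofReal ε ≤ transportCost c P (empirical ξ)}
      ⊆ {ξ : Fin N → X | Z ≤ ENNReal.ofReal (∏ i, f (ξ i))} := by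
    intro ξ hξ
    have := isProbabilityMeasure_empirical hN ξ
    have h1 := hξ.out.trans (transportCost_le_lintegral_add (ρ := fun x => ENNReal.ofReal (ρ x))
      (by fun_prop) (fun x y => (hc x y).trans ENNReal.ofReal_add_le) P (empirical ξ))
    rw [lintegral_empirical ξ (by fun_prop), ← ENNReal.ofReal_sum_of_nonneg fun i _ => hρ0 _,
      ← ENNReal.div_eq_inv_mul, ← ENNReal.ofReal_natCast, ← ENNReal.ofReal_div_of_pos hN0] at h1
    have hmean0 : 0 ≤ (∑ i, ρ (ξ i)) / N := div_nonneg (Finset.sum_nonneg fun i _ => hρ0 _) hN0.le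
    have h2 := h1.trans (add_le_add_left hρM _)
    rw [← ENNReal.ofReal_add (by linarith) hmean0,
      ENNReal.ofReal_le_ofReal_iff (by linarith)] at h2
    have h3 : ε / 2 ≤ ∑ i, (1 / N : ℝ) * ρ (ξ i) := by
      rw [← Finset.mul_sum, one_div_mul_eq_div]; linarith
    have h4 := Real.rpow_arith_mean_le_arith_mean_rpow Finset.univ (fun _ : Fin N => (1 / N : ℝ))
      (fun i => ρ (ξ i)) (fun _ _ => by positivity) (by simp; field_simp) (fun i _ => hρ0 _) ha.le
    have h5 : (ε / 2) ^ a ≤ ∑ i, (1 / N : ℝ) * ρ (ξ i) ^ a :=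
      (Real.rpow_le_rpow (by positivity) h3 (by linarith)).trans h4
    refine ENNReal.ofReal_le_ofReal ?_
    simp only [hf]
    rw [← Real.exp_sum]
    refine Real.exp_le_exp.2 ?_
    rw [← Finset.mul_sum, one_div_mul_eq_div, le_div_iff₀ hN0] at h5
    linarith
  have hprod : ∫⁻ ξ, ENNReal.ofReal (∏ i, f (ξ i)) ∂(Measure.pi fun _ : Fin N => P)
      ≤ ENNReal.ofReal (M ^ N) := by
    rw [← ofReal_integral_eq_lintegral_ofReal (Integrable.fintype_prod fun _ => hfi)
      (ae_of_all _ fun ξ => Finset.prod_nonneg fun _ _ => (Real.exp_pos _).le)]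
    refine ENNReal.ofReal_le_ofReal ?_
    rw [integral_fintype_prod_eq_pow (ι := Fin N) f, Fintype.card_fin]
    gcongr
  have hMexp : M ^ N ≤ Real.exp (N * ((ε / 2) ^ a / 2)) := by
    rw [Real.exp_nat_mul]
    gcongr
    have h1 : ε / 2 ≤ (ε / 2) ^ a := by
      calc ε / 2 = (ε / 2) ^ (1 : ℝ) := (Real.rpow_one _).symm
        _ ≤ _ := Real.rpow_le_rpow_of_exponent_le (by linarith) ha.le
    calc M ≤ M - 1 + 1 := by linarith
      _ ≤ Real.exp (M - 1) := Real.add_one_le_exp _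
      _ ≤ _ := Real.exp_le_exp.2 (by linarith)
  calc _ ≤ Measure.pi (fun _ : Fin N => P) {ξ | Z ≤ ENNReal.ofReal (∏ i, f (ξ i))} :=
        measure_mono hsub
    _ ≤ (∫⁻ ξ, ENNReal.ofReal (∏ i, f (ξ i)) ∂(Measure.pi fun _ : Fin N => P)) / Z :=
        meas_ge_le_lintegral_div (Finset.measurable_prod _ fun i _ =>
          hfm.exp.comp (measurable_pi_apply i)).ennreal_ofReal.aemeasurable
          (ENNReal.ofReal_pos.2 (Real.exp_pos _)).ne' ENNReal.ofReal_ne_top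
    _ ≤ ENNReal.ofReal (Real.exp (N * ((ε / 2) ^ a / 2))) / Z := by
        gcongr; exact hprod.trans (ENNReal.ofReal_le_ofReal hMexp)
    _ = _ := by
        rw [hZ, ← ENNReal.ofReal_div_of_pos (Real.exp_pos _), ← Real.exp_sub]
        congr 2; ring

/-- **Concentration of the empirical distribution in transport cost.** The constants depend only on
the tail exponent `a`, the dimension `d` and the bound `M` for the exponential moment. The function
`ρ` stands for the norm of a point, and `c` for the distance of two points. -/
theorem exists_concentration_constants {a : ℝ} (ha : 1 < a) {d : ℕ} (hd : 3 ≤ d) (M : ℝ) :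
    ∃ c₁ c₂ : ℝ, 1 ≤ c₁ ∧ 0 < c₂ ∧ ∀ {X ι : Type} [MeasurableSpace X] [Fintype ι],
      Fintype.card ι = d → ∀ {φ : X → ι → ℝ}, Measurable φ → ∀ {ρ : X → ℝ}, Measurable ρ →
      (∀ x j, |φ x j| ≤ ρ x) → ∀ {c : X → X → ℝ≥0∞},
      (∀ x y, c x y ≤ ENNReal.ofReal (ρ x + ρ y)) →
      (∀ x y, c x y ≤ ENNReal.ofReal (∑ j, |φ x j - φ y j|)) →
      ∀ (P : Measure X) [IsProbabilityMeasure P],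
        ∫⁻ x, ENNReal.ofReal (Real.exp (ρ x ^ a)) ∂P ≤ ENNReal.ofReal M →
      ∀ N : ℕ, 1 ≤ N → ∀ ε : ℝ, 0 < ε →
        Measure.pi (fun _ : Fin N => P) {ξ | ENNReal.ofReal ε ≤ transportCost c P (empirical ξ)}
          ≤ ENNReal.ofReal (concentrationBound c₁ c₂ a d N ε) := by
  set M' := max M 1
  have hM' : 1 ≤ M' := le_max_right _ _
  have hd3 : (3 : ℝ) ≤ d := by exact_mod_cast hd
  -- `K` bounds the exponential moment that the concentration of the discrepancy requires
  set K := Real.exp ((3 * d : ℝ) ^ (a / (a - 1)) + 12 * d) * M' with hKdef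
  have hK1 : 1 ≤ K := one_le_mul_of_one_le_of_one_le (Real.one_le_exp (by positivity)) hM'
  -- below this value of `N ε ^ d` the bound is trivial thanks to `c₁ = exp (k C)`
  set C := (16 * d * (K + 4 ^ d)) ^ 2 * (8 * d : ℝ) ^ (d - 2) with hC
  have hC0 : 0 ≤ C := by positivity
  set k := 1 / (32 * (K * Real.exp K)) with hk
  have hk0 : 0 < k := by positivity
  have h4M : 0 < (4 * M') ^ a := by positivity
  have h4M1 : 1 ≤ (4 * M') ^ a := Real.one_le_rpow (by linarith) (by linarith)
  -- the first term serves for `ε ≤ 4 M'`, the second for `4 M' ≤ ε`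
  set c₂ := min (k / (4 * M') ^ a) ((1 / 2) ^ a / 2) with hc₂
  have hc₂0 : 0 < c₂ := lt_min (by positivity) (by positivity)
  have hc₂k : c₂ ≤ k := (min_le_left _ _).trans (div_le_self hk0.le h4M1)
  have hc₁ : 1 ≤ Real.exp (k * C) := Real.one_le_exp (by positivity)
  refine ⟨Real.exp (k * C), c₂, hc₁, hc₂0, ?_⟩
  intro X ι _ _ hcard φ hφ ρ hρm hρ c hcρ hcφ P _ hM N hN ε hε
  have hN0 : (0 : ℝ) < N := by exact_mod_cast hN
  have : Nonempty ι := Fintype.card_pos_iff.1 (by omega)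
  have hρ0 (x : X) : 0 ≤ ρ x := (abs_nonneg _).trans (hρ x (Classical.arbitrary ι))
  have hMM : ∫⁻ x, ENNReal.ofReal (Real.exp (ρ x ^ a)) ∂P ≤ ENNReal.ofReal M' :=
    hM.trans (ENNReal.ofReal_le_ofReal (le_max_left _ _))
  have hK : ∫⁻ x, ENNReal.ofReal (Real.exp (3 * (Fintype.card ι * (ρ x + 4)))) ∂P
      ≤ ENNReal.ofReal K := by
    rw [hcard]
    refine le_trans (le_of_eq ?_)
      (lintegral_exp_mul_add_le ha hρm hρ0 hMM (s := 3 * d) (by positivity) (12 * d))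
    refine lintegral_congr fun x => ?_
    congr 2; ring
  have hsmall {ε : ℝ} (hε : 0 < ε) (hε1 : ε ≤ 1) :
      Measure.pi (fun _ : Fin N => P) {ξ | ENNReal.ofReal ε ≤ transportCost c P (empirical ξ)}
        ≤ ENNReal.ofReal (Real.exp (k * C) * Real.exp (-k * N * ε ^ d)) := by
    rw [← Real.exp_add]
    rcases le_total C (N * ε ^ d) with h | h
    · refine (measure_mono fun ξ hξ => ?_).trans ((measure_transportCost_ge_le hφ (hcard ▸ hd) hρm
        hρ hK1 hK hN hε hε1 (by rw [hcard]; exact h)).trans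
          (ENNReal.ofReal_le_ofReal (Real.exp_le_exp.2 ?_)))
      · exact hξ.out.trans (transportCost_mono hcφ _ _)
      · have h1 : ε ^ d ≤ ε ^ 2 := pow_le_pow_of_le_one hε.le hε1 (by omega)
        have h2 : N * ε ^ 2 / (32 * (K * Real.exp K)) = k * N * ε ^ 2 := by rw [hk]; ring
        have h3 : k * N * ε ^ d ≤ k * N * ε ^ 2 := by gcongr
        have h4 : 0 ≤ k * C := by positivity
        rw [h2]; linarith
    · refine prob_le_one.trans ?_
      rw [ENNReal.one_le_ofReal]
      refine Real.one_le_exp ?_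
      have : k * (N * ε ^ d) ≤ k * C := by gcongr
      linarith
  unfold concentrationBound
  split_ifs with h1
  · refine (hsmall hε h1).trans (ENNReal.ofReal_le_ofReal ?_)
    have : -k * N * ε ^ d ≤ -c₂ * N * ε ^ d := by gcongr
    gcongr
  · rw [not_le] at h1
    rcases le_total ε (4 * M') with h2 | h2
    · refine (measure_mono fun ξ hξ => ?_).trans ((hsmall one_pos le_rfl).trans
        (ENNReal.ofReal_le_ofReal ?_))
      · exact (ENNReal.ofReal_le_ofReal h1.le).trans hξ.out
      · have h3 : c₂ * ε ^ a ≤ k := by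
          calc c₂ * ε ^ a ≤ k / (4 * M') ^ a * (4 * M') ^ a := by
                gcongr
                exact min_le_left _ _
            _ = k := by field_simp
        rw [one_pow, mul_one]
        refine mul_le_mul_of_nonneg_left (Real.exp_le_exp.2 ?_) (Real.exp_pos _).le
        nlinarith
    · refine (measure_transportCost_ge_le_of_large ha hρm hρ0 hcρ hM' hMM hN h2).trans
        (ENNReal.ofReal_le_ofReal ?_)
      refine le_trans ?_ (le_mul_of_one_le_left (Real.exp_pos _).le hc₁)
      refine Real.exp_le_exp.2 ?_
      have h3 : (ε / 2) ^ a / 2 = (1 / 2) ^ a / 2 * ε ^ a := by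
        rw [div_eq_mul_one_div ε 2, Real.mul_rpow hε.le (by norm_num)]; ring
      have h4 : c₂ * ε ^ a ≤ (1 / 2) ^ a / 2 * ε ^ a := by gcongr; exact min_le_right _ _
      rw [h3]
      nlinarith

/-! ### The `r`-norm -/

section RNorm

variable {ι κ : Type*} [Fintype ι] [Fintype κ] {r q : ℝ≥0∞}

theorem rNorm_nonneg [Fact (1 ≤ r)] (x : ι → ℝ) : 0 ≤ rNorm r x := norm_nonneg _

theorem rNorm_sub_le [Fact (1 ≤ r)] (x y : ι → ℝ) : rNorm r (x - y) ≤ rNorm r x + rNorm r y :=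
  norm_sub_le (WithLp.toLp r x) (WithLp.toLp r y)

theorem abs_apply_le_rNorm [Fact (1 ≤ r)] (x : ι → ℝ) (i : ι) : |x i| ≤ rNorm r x :=
  PiLp.norm_apply_le (WithLp.toLp r x : PiLp r fun _ : ι => ℝ) i

theorem continuous_rNorm [Fact (1 ≤ r)] : Continuous (rNorm r : (ι → ℝ) → ℝ) :=
  (PiLp.continuous_toLp r fun _ : ι => ℝ).norm

theorem rNorm_zero [Fact (1 ≤ r)] : rNorm r (0 : ι → ℝ) = 0 :=
  norm_zero (E := PiLp r fun _ : ι => ℝ)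

theorem rNorm_le_sum_abs [Fact (1 ≤ r)] (x : ι → ℝ) : rNorm r x ≤ ∑ i, |x i| := by
  classical
  have h : (WithLp.toLp r x : PiLp r fun _ : ι => ℝ)
      = ∑ i, WithLp.toLp r (Pi.single i (x i)) := by
    rw [← WithLp.toLp_sum, Finset.univ_sum_single]
  rw [rNorm, h]
  refine (norm_sum_le _ _).trans_eq (Finset.sum_congr rfl fun i _ => ?_)
  exact (PiLp.norm_single r (fun _ : ι => ℝ) i (x i)).trans (Real.norm_eq_abs _)

theorem rNorm_top (x : ι → ℝ) : rNorm ∞ x = ⨆ i, |x i| := PiLp.norm_eq_ciSup _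

theorem rNorm_eq_sum (hr : 0 < r.toReal) (x : ι → ℝ) :
    rNorm r x = (∑ i, |x i| ^ r.toReal) ^ (1 / r.toReal) := PiLp.norm_eq_sum hr _

theorem rNorm_comp_le [Fact (1 ≤ r)] {e : ι → κ} (he : Function.Injective e) (x : κ → ℝ) :
    rNorm r (fun i => x (e i)) ≤ rNorm r x := by
  rcases eq_or_ne r ∞ with rfl | h
  · rw [rNorm_top]
    exact Real.iSup_le (fun i => abs_apply_le_rNorm x (e i)) (rNorm_nonneg x)
  · have hr : 0 < r.toReal :=
      ENNReal.toReal_pos (zero_lt_one.trans_le (Fact.out : 1 ≤ r)).ne' h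
    rw [rNorm_eq_sum hr, rNorm_eq_sum hr]
    gcongr
    refine (Finset.sum_map Finset.univ ⟨e, he⟩ fun k => |x k| ^ r.toReal).symm.trans_le ?_
    exact Finset.sum_le_sum_of_subset_of_nonneg (Finset.subset_univ _) fun _ _ _ => by positivity

/-- Hölder's inequality for the rows of a matrix: the `r`-norm of `A *ᵥ g` is at most the
entrywise `r`-norm of `A` times the dual norm of `g`. -/
theorem rNorm_mulVec_le [Fact (1 ≤ r)] [Fact (1 ≤ q)] (hrq : r⁻¹ + q⁻¹ = 1) (A : Matrix ι κ ℝ)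
    (g : κ → ℝ) :
    rNorm r (A *ᵥ g) ≤ rNorm r (fun ij : ι × κ => A ij.1 ij.2) * rNorm q g := by
  have habs (i : ι) : |(A *ᵥ g) i| ≤ ∑ j, |A i j| * |g j| := by
    refine (Finset.abs_sum_le_sum_abs _ _).trans_eq ?_
    simp_rw [abs_mul]
  have hA0 := rNorm_nonneg (r := r) (fun ij : ι × κ => A ij.1 ij.2)
  have hg0 := rNorm_nonneg (r := q) g
  rcases eq_or_ne r ∞ with rfl | hr
  · have hq : q = 1 := by simpa using hrq
    subst hq
    have hg : rNorm 1 g = ∑ j, |g j| := by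
      rw [rNorm_eq_sum (by simp)]; simp
    rw [rNorm_top (A *ᵥ g)]
    refine Real.iSup_le (fun i => (habs i).trans ?_) (by positivity)
    rw [hg, Finset.mul_sum]
    refine Finset.sum_le_sum fun j _ => ?_
    gcongr
    exact abs_apply_le_rNorm (fun ij : ι × κ => A ij.1 ij.2) (i, j)
  rcases eq_or_ne q ∞ with rfl | hq
  · have hr1 : r = 1 := by simpa using hrq
    subst hr1
    rw [rNorm_eq_sum (by simp), rNorm_eq_sum (by simp)]
    simp only [ENNReal.toReal_one, Real.rpow_one, div_one]
    rw [Fintype.sum_prod_type, Finset.sum_mul]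
    refine Finset.sum_le_sum fun i _ => (habs i).trans ?_
    rw [Finset.sum_mul]
    refine Finset.sum_le_sum fun j _ => ?_
    gcongr
    exact abs_apply_le_rNorm g j
  · have hr0 : 0 < r.toReal :=
      ENNReal.toReal_pos (zero_lt_one.trans_le (Fact.out : 1 ≤ r)).ne' hr
    have hq0 : 0 < q.toReal :=
      ENNReal.toReal_pos (zero_lt_one.trans_le (Fact.out : 1 ≤ q)).ne' hq
    have : r.HolderConjugate q := ⟨by rw [hrq, inv_one]⟩
    have hconj := ENNReal.HolderConjugate.toReal_of_ne_top hr hq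
    rw [rNorm_eq_sum hr0 (A *ᵥ g), rNorm_eq_sum hr0 (fun ij : ι × κ => A ij.1 ij.2), one_div,
      Real.rpow_inv_le_iff_of_pos (Finset.sum_nonneg fun _ _ => by positivity)
        (by positivity) hr0, Real.mul_rpow (by positivity) hg0, ← Real.rpow_mul (by positivity),
      inv_mul_cancel₀ hr0.ne', Real.rpow_one, Fintype.sum_prod_type, Finset.sum_mul]
    refine Finset.sum_le_sum fun i _ => ?_
    have h := Real.inner_le_Lp_mul_Lq Finset.univ (fun j => |A i j|) (fun j => |g j|) hconj
    simp only [abs_abs] at h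
    rw [← rNorm_eq_sum hq0 g] at h
    calc |(A *ᵥ g) i| ^ r.toReal
        ≤ ((∑ j, |A i j| ^ r.toReal) ^ (1 / r.toReal) * rNorm q g) ^ r.toReal := by
          gcongr; exact (habs i).trans h
      _ = _ := by
          rw [Real.mul_rpow (by positivity) hg0, ← Real.rpow_mul (by positivity), one_div,
            inv_mul_cancel₀ hr0.ne', Real.rpow_one]

end RNorm

section DataNorm

variable {p Tini Tf T : ℕ} {r q : ℝ≥0∞}

/-- The entries of an output data matrix, as one long vector. -/
def dataVector (ξ : OutputData p Tini Tf T) :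
    (Fin (Tini + Tf) × Fin p) × Fin (T / (Tini + Tf)) → ℝ := fun ij => ξ ij.1 ij.2

theorem continuous_dataVector : Continuous (dataVector : OutputData p Tini Tf T → _) := by
  unfold dataVector; fun_prop

theorem continuous_dataNorm [Fact (1 ≤ r)] :
    Continuous (dataNorm r : OutputData p Tini Tf T → ℝ) :=
  continuous_rNorm.comp continuous_dataVector

theorem dataNorm_nonneg [Fact (1 ≤ r)] (ξ : OutputData p Tini Tf T) : 0 ≤ dataNorm r ξ :=
  rNorm_nonneg (dataVector ξ)

/-- The stacked vector of future and past outputs predicted by `g` is a Lipschitz function of the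
output data. -/
theorem rNorm_stacked_le [Fact (1 ≤ r)] [Fact (1 ≤ q)] (hrq : r⁻¹ + q⁻¹ = 1)
    (ξ : OutputData p Tini Tf T) (g : Fin (T / (Tini + Tf)) → ℝ) :
    rNorm r (Sum.elim (futureRows ξ *ᵥ g) (pastRows ξ *ᵥ g)) ≤ dataNorm r ξ * rNorm q g := by
  set e : (Fin Tf × Fin p) ⊕ (Fin Tini × Fin p) → Fin (Tini + Tf) × Fin p :=
    Sum.elim (fun i => (Fin.natAdd Tini i.1, i.2)) fun i => (Fin.castAdd Tf i.1, i.2) with he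
  have hinj : Function.Injective e := by
    rintro (⟨i, k⟩ | ⟨i, k⟩) (⟨i', k'⟩ | ⟨i', k'⟩) h <;>
      simp only [he, Sum.elim_inl, Sum.elim_inr, Prod.mk.injEq, Fin.ext_iff, Fin.val_natAdd,
        Fin.val_castAdd] at h
    · simp only [Sum.inl.injEq, Prod.mk.injEq, Fin.ext_iff]; omega
    · have := i'.isLt; omega
    · have := i.isLt; omega
    · simp only [Sum.inr.injEq, Prod.mk.injEq, Fin.ext_iff]; omega
  have h1 : Sum.elim (futureRows ξ *ᵥ g) (pastRows ξ *ᵥ g)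
      = Matrix.mulVec (fun i j => ξ (e i) j) g := by
    ext i; rcases i with i | i <;> rfl
  rw [h1]
  refine (rNorm_mulVec_le hrq _ g).trans (mul_le_mul_of_nonneg_right ?_ (rNorm_nonneg g))
  exact rNorm_comp_le (e := fun ij : _ × Fin (T / (Tini + Tf)) => (e ij.1, ij.2))
    (fun x y h => Prod.ext (hinj (Prod.mk.inj h).1) (Prod.mk.inj h).2) (dataVector ξ)

theorem rNorm_futureRows_mulVec_le [Fact (1 ≤ r)] [Fact (1 ≤ q)] (hrq : r⁻¹ + q⁻¹ = 1)
    (ξ : OutputData p Tini Tf T) (g : Fin (T / (Tini + Tf)) → ℝ) :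
    rNorm r (futureRows ξ *ᵥ g) ≤ dataNorm r ξ * rNorm q g :=
  (rNorm_comp_le Sum.inl_injective (Sum.elim (futureRows ξ *ᵥ g) (pastRows ξ *ᵥ g))).trans
    (rNorm_stacked_le hrq ξ g)

theorem futureRows_sub_mulVec (ξ ξ' : OutputData p Tini Tf T) (g : Fin (T / (Tini + Tf)) → ℝ) :
    futureRows ξ *ᵥ g - futureRows ξ' *ᵥ g = futureRows (ξ - ξ') *ᵥ g := by
  rw [← Matrix.sub_mulVec]; rfl

theorem pastRows_sub_mulVec (ξ ξ' : OutputData p Tini Tf T) (g : Fin (T / (Tini + Tf)) → ℝ) :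
    pastRows ξ *ᵥ g - pastRows ξ' *ᵥ g = pastRows (ξ - ξ') *ᵥ g := by
  rw [← Matrix.sub_mulVec]; rfl

namespace Problem

variable {m : ℕ}

theorem abs_cost_sub_le [Fact (1 ≤ r)] [Fact (1 ≤ q)] (hrq : r⁻¹ + q⁻¹ = 1)
    (D : Problem m p Tini Tf T r) (g : Fin (T / (Tini + Tf)) → ℝ) (ξ ξ' : OutputData p Tini Tf T) :
    |D.cost g ξ - D.cost g ξ'| ≤ D.Lobj * rNorm q g * dataNorm r (ξ - ξ') := by
  have h := D.objective_lipschitz.2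
    (Sum.elim (futureRows ξ *ᵥ g) (pastRows ξ *ᵥ g - D.yIni))
    (Sum.elim (futureRows ξ' *ᵥ g) (pastRows ξ' *ᵥ g - D.yIni))
  have e : Sum.elim (futureRows ξ *ᵥ g) (pastRows ξ *ᵥ g - D.yIni)
      - Sum.elim (futureRows ξ' *ᵥ g) (pastRows ξ' *ᵥ g - D.yIni)
      = Sum.elim (futureRows (ξ - ξ') *ᵥ g) (pastRows (ξ - ξ') *ᵥ g) := by
    rw [← futureRows_sub_mulVec, ← pastRows_sub_mulVec]
    ext i; rcases i with i | i <;> simp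
  rw [e] at h
  simp only [Sum.elim_inl, Sum.elim_inr] at h
  have h2 : D.cost g ξ - D.cost g ξ' = D.f₂ (futureRows ξ *ᵥ g) + D.f₃ (pastRows ξ *ᵥ g - D.yIni)
      - (D.f₂ (futureRows ξ' *ᵥ g) + D.f₃ (pastRows ξ' *ᵥ g - D.yIni)) := by
    simp only [cost]; ring
  rw [h2]
  refine h.trans ?_
  rw [mul_assoc, mul_comm (rNorm q g)]
  exact mul_le_mul_of_nonneg_left (rNorm_stacked_le hrq _ g) D.objective_lipschitz.1.le

theorem abs_constraint_sub_le [Fact (1 ≤ r)] [Fact (1 ≤ q)] (hrq : r⁻¹ + q⁻¹ = 1)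
    (D : Problem m p Tini Tf T r) (g : Fin (T / (Tini + Tf)) → ℝ) (ξ ξ' : OutputData p Tini Tf T) :
    |D.constraint g ξ - D.constraint g ξ'| ≤ D.Lcon * rNorm q g * dataNorm r (ξ - ξ') := by
  refine (D.h_lipschitz.2 _ _).trans ?_
  rw [futureRows_sub_mulVec, mul_assoc, mul_comm (rNorm q g)]
  exact mul_le_mul_of_nonneg_left (rNorm_futureRows_mulVec_le hrq _ g) D.h_lipschitz.1.le

end Problem

/-! ### Integrals of Lipschitz functions -/

theorem continuous_of_abs_sub_le [Fact (1 ≤ r)] {f : OutputData p Tini Tf T → ℝ} {C : ℝ}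
    (hf : ∀ ξ ξ', |f ξ - f ξ'| ≤ C * dataNorm r (ξ - ξ')) : Continuous f := by
  refine continuous_iff_continuousAt.2 fun ξ => ?_
  rw [ContinuousAt, tendsto_iff_dist_tendsto_zero]
  refine squeeze_zero (fun _ => dist_nonneg) (fun ξ' => hf ξ' ξ) ?_
  have h : Continuous fun ξ' : OutputData p Tini Tf T => C * dataNorm r (ξ' - ξ) :=
    (continuous_dataNorm.comp (continuous_id.sub continuous_const)).const_mul C
  have h0 : C * dataNorm r (ξ - ξ) = 0 := by
    rw [sub_self, show dataNorm r (0 : OutputData p Tini Tf T) = 0 from rNorm_zero, mul_zero]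
  simpa only [h0] using h.tendsto ξ

theorem integrable_of_abs_sub_le [Fact (1 ≤ r)] {P : Measure (OutputData p Tini Tf T)}
    [IsFiniteMeasure P] (hP : Integrable (dataNorm r) P) {f : OutputData p Tini Tf T → ℝ} {C : ℝ}
    (hf : ∀ ξ ξ', |f ξ - f ξ'| ≤ C * dataNorm r (ξ - ξ')) : Integrable f P := by
  refine ((hP.const_mul C).add (integrable_const |f 0|)).mono'
    (continuous_of_abs_sub_le hf).measurable.aestronglyMeasurable (ae_of_all _ fun ξ => ?_)
  have h := hf ξ 0
  rw [sub_zero] at h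
  have := abs_sub_abs_le_abs_sub (f ξ) (f 0)
  simp only [Real.norm_eq_abs, Pi.add_apply]
  linarith

/-- The elementary half of Kantorovich duality: integrals of Lipschitz functions differ by at most
the Lipschitz constant times the transport cost. -/
theorem integral_le_of_transportCost_lt {X : Type*} [MeasurableSpace X] {μ ν : Measure X}
    {c : X → X → ℝ} (hcm : Measurable fun z : X × X => c z.1 z.2) (hc0 : ∀ x y, 0 ≤ c x y)
    {ε : ℝ} (hε : 0 ≤ ε)
    (h : transportCost (fun x y => ENNReal.ofReal (c x y)) μ ν < ENNReal.ofReal ε) {f : X → ℝ}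
    (hμ : Integrable f μ) (hν : Integrable f ν) {C : ℝ} (hC : 0 ≤ C)
    (hf : ∀ x y, f x - f y ≤ C * c x y) :
    ∫ x, f x ∂μ ≤ ∫ x, f x ∂ν + C * ε := by
  simp only [transportCost, iInf_lt_iff] at h
  obtain ⟨γ, ⟨rfl, rfl⟩, hγ⟩ := h
  have hci : Integrable (fun z : X × X => c z.1 z.2) γ := by
    refine ⟨hcm.aestronglyMeasurable, ?_⟩
    rw [hasFiniteIntegral_iff_ofReal (ae_of_all _ fun z => hc0 _ _)]
    exact hγ.trans ENNReal.ofReal_lt_top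
  have hcε : ∫ z, c z.1 z.2 ∂γ ≤ ε := by
    rw [integral_eq_lintegral_of_nonneg_ae (ae_of_all _ fun z => hc0 _ _) hci.aestronglyMeasurable]
    exact ENNReal.toReal_le_of_le_ofReal hε hγ.le
  have h1 := hμ.comp_measurable measurable_fst
  have h2 := hν.comp_measurable measurable_snd
  rw [integral_map measurable_fst.aemeasurable hμ.aestronglyMeasurable,
    integral_map measurable_snd.aemeasurable hν.aestronglyMeasurable]
  have h3 : ∫ z, (f z.1 - f z.2) ∂γ ≤ ∫ z, C * c z.1 z.2 ∂γ :=
    integral_mono (h1.sub h2) (hci.const_mul C) fun z => hf _ _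
  have h4 : ∫ z : X × X, (f z.1 - f z.2) ∂γ = ∫ z : X × X, f z.1 ∂γ - ∫ z : X × X, f z.2 ∂γ :=
    integral_sub h1 h2
  rw [h4, integral_const_mul] at h3
  have h5 : C * ∫ z, c z.1 z.2 ∂γ ≤ C * ε := by gcongr
  linarith

theorem integrable_empirical {X : Type*} [MeasurableSpace X] {N : ℕ} (hN : 1 ≤ N) (ξ : Fin N → X)
    {f : X → ℝ} (hf : Measurable f) : Integrable f (empirical ξ) := by
  refine Integrable.smul_measure ?_ (by simp; omega)
  rw [integrable_finsetSum_measure]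
  refine fun i _ => ⟨hf.aestronglyMeasurable, ?_⟩
  rw [HasFiniteIntegral, lintegral_dirac' _ (by fun_prop)]
  simp

theorem integral_empirical {X : Type*} [MeasurableSpace X] {N : ℕ} (ξ : Fin N → X)
    {f : X → ℝ} (hf : Measurable f) :
    ∫ x, f x ∂(empirical ξ) = 1 / (N : ℝ) * ∑ i, f (ξ i) := by
  have hfi (i : Fin N) : Integrable f (Measure.dirac (ξ i)) := by
    refine ⟨hf.aestronglyMeasurable, ?_⟩
    rw [HasFiniteIntegral, lintegral_dirac' _ (by fun_prop)]
    simp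
  rw [empirical, integral_smul_measure, integral_finsetSum_measure fun i _ => hfi i]
  simp [integral_dirac' _ _ hf.stronglyMeasurable]

/-! ### The performance guarantee -/

theorem cvar_le {Ω : Type*} [MeasurableSpace Ω] {P : Measure Ω} [IsProbabilityMeasure P] {α : ℝ}
    (h0 : 0 < α) (h1 : α ≤ 1) {X : Ω → ℝ} (hX : Integrable X P) (τ : ℝ) :
    cvar α P X ≤ τ + 1 / α * ∫ ω, max (X ω - τ) 0 ∂P := by
  refine ciInf_le ⟨∫ ω, X ω ∂P, ?_⟩ τ
  rintro _ ⟨τ, rfl⟩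
  have hi : Integrable (fun ω => X ω - τ) P := hX.sub (integrable_const τ)
  have h2 : ∫ ω, X ω ∂P - τ ≤ ∫ ω, max (X ω - τ) 0 ∂P := by
    have e : ∫ ω, (X ω - τ) ∂P = ∫ ω, X ω ∂P - τ := by
      rw [integral_sub hX (integrable_const τ)]; simp
    rw [← e]
    exact integral_mono hi hi.pos_part fun ω => le_max_left _ _
  have h3 : 0 ≤ ∫ ω, max (X ω - τ) 0 ∂P := integral_nonneg fun ω => le_max_right _ _
  have h4 : 1 ≤ 1 / α := by rw [le_div_iff₀ h0]; linarith
  dsimp only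
  nlinarith

namespace Problem

variable {m N : ℕ}

theorem expectedCost_le_objective [Fact (1 ≤ r)] [Fact (1 ≤ q)] (hrq : r⁻¹ + q⁻¹ = 1)
    (D : Problem m p Tini Tf T r) {P : Measure (OutputData p Tini Tf T)} [IsProbabilityMeasure P]
    (hP : Integrable (dataNorm r) P) (hN : 1 ≤ N) {ε : ℝ} (hε : 0 ≤ ε)
    {ξ : Fin N → OutputData p Tini Tf T}
    (h : wassersteinDist r P (empirical ξ) < ENNReal.ofReal ε) (g : Fin (T / (Tini + Tf)) → ℝ) :
    D.expectedCost P g ≤ D.objective q ε ξ g := by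
  have hlip := D.abs_cost_sub_le hrq g
  have hm := (continuous_of_abs_sub_le hlip).measurable
  have hC : 0 ≤ D.Lobj * rNorm q g := mul_nonneg D.objective_lipschitz.1.le (rNorm_nonneg g)
  have h1 := integral_le_of_transportCost_lt (c := fun x y => dataNorm r (x - y))
    (continuous_dataNorm.comp (continuous_fst.sub continuous_snd)).measurable
    (fun _ _ => dataNorm_nonneg _) hε h (integrable_of_abs_sub_le hP hlip)
    (integrable_empirical hN ξ hm) hC fun x y => (le_abs_self _).trans (hlip x y)
  rw [integral_empirical ξ hm] at h1
  refine h1.trans_eq ?_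
  have hN0 : (N : ℝ) ≠ 0 := by exact_mod_cast (by omega : N ≠ 0)
  simp only [objective, cost, add_assoc, Finset.sum_add_distrib (f := fun _ => D.f₁ (D.Uf *ᵥ g))]
  simp only [Finset.sum_const, Finset.card_univ, Fintype.card_fin, nsmul_eq_mul]
  field_simp
  ring

theorem cvar_constraint_nonpos [Fact (1 ≤ r)] [Fact (1 ≤ q)] (hrq : r⁻¹ + q⁻¹ = 1)
    (D : Problem m p Tini Tf T r) {P : Measure (OutputData p Tini Tf T)} [IsProbabilityMeasure P]
    (hP : Integrable (dataNorm r) P) (hN : 1 ≤ N) {ε : ℝ} (hε : 0 ≤ ε)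
    {ξ : Fin N → OutputData p Tini Tf T}
    (h : wassersteinDist r P (empirical ξ) < ENNReal.ofReal ε) {g : Fin (T / (Tini + Tf)) → ℝ}
    {τ : ℝ} {s : Fin N → ℝ} (hfeas : D.Feasible q ε ξ g τ s) :
    cvar D.α P (D.constraint g) ≤ 0 := by
  obtain ⟨-, -, hbudget, hs, hs0⟩ := hfeas
  have hlip := D.abs_constraint_sub_le hrq g
  -- the positive part is `1`-Lipschitz
  have hlip' (x y : OutputData p Tini Tf T) :
      |max (D.constraint g x - -τ) 0 - max (D.constraint g y - -τ) 0|
        ≤ D.Lcon * rNorm q g * dataNorm r (x - y) := by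
    refine (abs_max_sub_max_le_abs _ _ _).trans ?_
    rw [sub_sub_sub_cancel_right]
    exact hlip x y
  have hm := (continuous_of_abs_sub_le hlip').measurable
  have hC : 0 ≤ D.Lcon * rNorm q g := mul_nonneg D.h_lipschitz.1.le (rNorm_nonneg g)
  have h1 := integral_le_of_transportCost_lt (c := fun x y => dataNorm r (x - y))
    (continuous_dataNorm.comp (continuous_fst.sub continuous_snd)).measurable
    (fun _ _ => dataNorm_nonneg _) hε h (integrable_of_abs_sub_le hP hlip')
    (integrable_empirical hN ξ hm) hC fun x y => (le_abs_self _).trans (hlip' x y)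
  rw [integral_empirical ξ hm] at h1
  have h2 : 1 / (N : ℝ) * ∑ i, max (D.constraint g (ξ i) - -τ) 0 ≤ 1 / (N : ℝ) * ∑ i, s i := by
    gcongr with i
    refine max_le ?_ (hs0 i)
    have := hs i
    simp only [constraint]
    linarith
  -- the feasible `τ` is minus the level at which the infimum in the CVaR is tested
  refine (cvar_le D.α_pos D.α_lt_one.le (integrable_of_abs_sub_le hP hlip) (-τ)).trans ?_
  have h3 : ∫ ω, max (D.constraint g ω - -τ) 0 ∂P ≤ τ * D.α := by linarith
  have h4 : 1 / D.α * ∫ ω, max (D.constraint g ω - -τ) 0 ∂P ≤ 1 / D.α * (τ * D.α) :=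
    mul_le_mul_of_nonneg_left h3 (one_div_pos.2 D.α_pos).le
  have h5 : 1 / D.α * (τ * D.α) = τ := by have := D.α_pos.ne'; field_simp
  linarith

end Problem

theorem wassersteinRadius_spec {c₁ c₂ a β : ℝ} {d N : ℕ} (hc₁ : 1 ≤ c₁) (hc₂ : 0 < c₂)
    (ha : 0 < a) (hd : d ≠ 0) (hβ0 : 0 < β) (hβ1 : β < 1) (hN : 1 ≤ N) :
    0 < wassersteinRadius c₁ c₂ a d β N ∧
      concentrationBound c₁ c₂ a d N (wassersteinRadius c₁ c₂ a d β N) = β := by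
  have hN0 : (0 : ℝ) < N := by exact_mod_cast hN
  have hd0 : (0 : ℝ) < d := by exact_mod_cast Nat.pos_of_ne_zero hd
  have hcβ : 1 < c₁ * β⁻¹ := by
    rw [← div_eq_mul_inv, one_lt_div hβ0]; linarith
  have hlog := Real.log_pos hcβ
  set l := Real.log (c₁ * β⁻¹) with hl
  have hx : 0 < l / (c₂ * N) := by positivity
  have hval : c₁ * Real.exp (-c₂ * N * (l / (c₂ * N))) = β := by
    have e : -c₂ * N * (l / (c₂ * N)) = -l := by field_simp
    rw [e, Real.exp_neg, hl, Real.exp_log (by linarith)]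
    field_simp
  unfold wassersteinRadius
  split_ifs with h
  · refine ⟨by positivity, ?_⟩
    have h1 : l / (c₂ * N) ≤ 1 := by
      rw [div_le_iff₀ hc₂] at h
      rw [div_le_one (by positivity)]; linarith
    rw [concentrationBound, if_pos (Real.rpow_le_one hx.le h1 (by positivity)), one_div,
      Real.rpow_inv_natCast_pow hx.le hd, hval]
  · refine ⟨by positivity, ?_⟩
    have h1 : 1 < l / (c₂ * N) := by
      rw [not_le, lt_div_iff₀ hc₂] at h
      rw [one_lt_div (by positivity)]; linarith
    rw [concentrationBound, if_neg (not_le.2 (Real.one_lt_rpow h1 (by positivity))), one_div,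
      Real.rpow_inv_rpow hx.le ha.ne', hval]

end DataNorm

end DeePC

theorem theorem4 (a : ℝ) (ha : 1 < a) (d : ℕ) (hd : 3 ≤ d) (M : ℝ) :
    ∃ c₁ c₂ : ℝ, 0 < c₁ ∧ 0 < c₂ ∧
      ∀ (p Tini Tf T : ℕ), p * (Tini + Tf) * (T / (Tini + Tf)) = d →
      ∀ (r q : ℝ≥0∞), r⁻¹ + q⁻¹ = 1 →
      ∀ (P : Measure (DeePC.OutputData p Tini Tf T)) [IsProbabilityMeasure P],
        ∫⁻ ξ, ENNReal.ofReal (Real.exp (DeePC.dataNorm r ξ ^ a)) ∂P ≤ ENNReal.ofReal M →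
      ∀ N : ℕ, 1 ≤ N →
        -- `c₁`, `c₂` are constants of the concentration bound
        (∀ ε : ℝ, 0 < ε →
          Measure.pi (fun _ : Fin N => P)
              {ξ | ENNReal.ofReal ε ≤ DeePC.wassersteinDist r P (DeePC.empirical ξ)}
            ≤ ENNReal.ofReal (DeePC.concentrationBound c₁ c₂ a d N ε)) ∧
        -- the performance guarantee for the radius obtained from that bound
        ∀ (m : ℕ) (D : DeePC.Problem m p Tini Tf T r) (β : ℝ), 0 < β → β < 1 →
          (∀ g, Integrable (D.cost g) P) ∧
          (∀ g, Integrable (D.constraint g) P) ∧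
          ∃ A : Set (Fin N → DeePC.OutputData p Tini Tf T),
            MeasurableSet A ∧
            ENNReal.ofReal (1 - β) ≤ Measure.pi (fun _ : Fin N => P) A ∧
            ∀ ξ ∈ A, ∀ g,
              D.IsOptimizer q (DeePC.wassersteinRadius c₁ c₂ a d β N) ξ g →
                D.expectedCost P g
                    ≤ D.objective q (DeePC.wassersteinRadius c₁ c₂ a d β N) ξ g ∧
                DeePC.cvar D.α P (D.constraint g) ≤ 0 := by
  obtain ⟨c₁, c₂, hc₁, hc₂, hconc⟩ := DeePC.exists_concentration_constants ha hd M
  refine ⟨c₁, c₂, by linarith, hc₂, ?_⟩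
  intro p Tini Tf T hcard r q hrq P _ hM N hN
  have : Fact (1 ≤ r) := ⟨by
    rw [← ENNReal.inv_le_one, ← hrq]; exact le_self_add⟩
  have : Fact (1 ≤ q) := ⟨by
    rw [← ENNReal.inv_le_one, ← hrq]; exact le_add_self⟩
  have hbound (ε : ℝ) (hε : 0 < ε) :
      Measure.pi (fun _ : Fin N => P)
          {ξ | ENNReal.ofReal ε ≤ DeePC.wassersteinDist r P (DeePC.empirical ξ)}
        ≤ ENNReal.ofReal (DeePC.concentrationBound c₁ c₂ a d N ε) := by
    refine hconc (φ := DeePC.dataVector) ?_ DeePC.continuous_dataVector.measurable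
      (ρ := DeePC.dataNorm r) DeePC.continuous_dataNorm.measurable
      (fun ξ => DeePC.abs_apply_le_rNorm (DeePC.dataVector ξ))
      (c := fun x y => ENNReal.ofReal (DeePC.dataNorm r (x - y)))
      (fun x y => ENNReal.ofReal_le_ofReal
        (DeePC.rNorm_sub_le (DeePC.dataVector x) (DeePC.dataVector y)))
      (fun x y => ENNReal.ofReal_le_ofReal (DeePC.rNorm_le_sum_abs (DeePC.dataVector (x - y))))
      P hM N hN ε hε
    simp only [Fintype.card_prod, Fintype.card_fin]
    rw [← hcard]; ring
  refine ⟨hbound, ?_⟩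
  intro m D β hβ0 hβ1
  have hnorm : Integrable (DeePC.dataNorm r) P := by
    refine (DeePC.integrable_exp_of_lintegral_le
      (DeePC.continuous_dataNorm.measurable.pow_const a) hM).mono'
      DeePC.continuous_dataNorm.measurable.aestronglyMeasurable (ae_of_all _ fun ξ => ?_)
    rw [Real.norm_of_nonneg (DeePC.dataNorm_nonneg ξ)]
    exact DeePC.le_exp_rpow ha.le (DeePC.dataNorm_nonneg ξ)
  refine ⟨fun g => DeePC.integrable_of_abs_sub_le hnorm (D.abs_cost_sub_le hrq g),
    fun g => DeePC.integrable_of_abs_sub_le hnorm (D.abs_constraint_sub_le hrq g), ?_⟩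
  obtain ⟨hε, hβ⟩ := DeePC.wassersteinRadius_spec hc₁ hc₂ (by linarith : 0 < a)
    (by omega : d ≠ 0) hβ0 hβ1 hN
  set ε := DeePC.wassersteinRadius c₁ c₂ a d β N
  -- the event that the Wasserstein ball contains `P` need not be measurable
  set bad := {ξ : Fin N → DeePC.OutputData p Tini Tf T |
    ENNReal.ofReal ε ≤ DeePC.wassersteinDist r P (DeePC.empirical ξ)}
  refine ⟨(toMeasurable (Measure.pi fun _ : Fin N => P) bad)ᶜ,
    (measurableSet_toMeasurable _ _).compl, ?_, ?_⟩
  · rw [prob_compl_eq_one_sub (measurableSet_toMeasurable _ _), measure_toMeasurable,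
      ENNReal.ofReal_sub _ hβ0.le, ENNReal.ofReal_one]
    exact tsub_le_tsub_left ((hbound ε hε).trans_eq (by rw [hβ])) 1
  · intro ξ hξ g hg
    have hW : DeePC.wassersteinDist r P (DeePC.empirical ξ) < ENNReal.ofReal ε :=
      not_le.1 fun h => hξ (subset_toMeasurable _ _ h)
    obtain ⟨τ, s, hfeas⟩ := hg.1
    exact ⟨D.expectedCost_le_objective hrq hnorm hN hε.le hW g,
      D.cvar_constraint_nonpos hrq hnorm hN hε.le hW hfeas⟩
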